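/- **Skeletons.** Signs $\{+,-\}$ are written as a group of order two; we also write $\forall$ for $+$ and $\exists$ for $-$. An $n$-ary *connective skeleton* is $c=(\sigma,(k_1,\dots,k_{n+1}),(\pm_1,\dots,\pm_{n+1}),\pm)$ with $\sigma\in\mathfrak S_{n+1}$, types $k_i\in\{1,2,\dots\}$ and signs $\pm_i,\pm$. Its output type is $k_{n+1}$, its tonicity in place $i\le n$ is $\pm_i(c)=\pm_i$, and its quantification sign is $Æ(c)=\pm_{n+1}\pm$. The *negation* $-c$ is obtained by switching all $n+1$ signs $\pm_i$. For a permutation $\rho$ of $\{1,\dots,n+1\}$, the skeleton $\rho c$ has permutation $\sigma\circ\rho$, types $k_{\rho(i)}$, the same last sign $\pm$, and signs given as follows. If $\rho(n+1)=n+1$, the $i$-th sign is $\pm_{\rho(i)}$. If $j=\rho(n+1)\ne n+1$, the $i$-th sign is $\pm_j$ when $\rho(i)=n+1$, and otherwise $-\pm_j\pm_{(j\ n+1)(\rho(i))}$. In particular $(j\ n{+}1)c$ is the $j$-th residual of $c$. **Families.** A *connective family* $C$ is a partitioned set of connectives, those of each class having a fixed arity and distinct skeletons, with types compatible along the permutations.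 Some classes of $0$-ary connectives consist of *variables*. The non-variable classes carry the actions $c\mapsto\rho c$ and $c\mapsto -c$, the variables the trivial action. $\mathcal O(C)$ is the closure of $C$ under these actions (each $\star\in\mathcal O(C)$ remembers its class). A *Boolean connective family* is a disjoint union $C=B\sqcup C'$, with $C'$ any connective family and $B$ consisting, for each type $k$ (all entries of type $k$), of at least one variable of each tonicity and of the connectives below, with classes $\{\bot,\top\},\{\neg\},\{\wedge,\vee,\to\}$ (permutation; signs; last sign): $\bot=(\mathrm{id};+;+)$, $\top=(\mathrm{id};-;+)$, $\neg=(\mathrm{id};-,+;-)$, $\wedge=(\mathrm{id};+,+,+;-)$, $\vee=(\mathrm{id};+,+,-;-)$, $\to\,=((2\ 3);-,+,-;-)$. We also use $\neg'=(\mathrm{id};-,-;-)\in\mathcal O(B)$. **Formulas and structures.** $\mathcal L_M$ is the set of typed formulas built from the connectives in $M$. *Structures* over $\mathcal L_C$ are built from the formulas $\varphi\in\mathcal L_C$ and the starred formulas $*\varphi$ by the structural connectives $[\star](X_1,\dots,X_n)$, $\star\in\mathcal O(C)$, and $*[p]$ for variables $p$. Boolean negation on structures is $**\varphi=\varphi$,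 $*[\star](X_1,\dots,X_n)=[-\star](X_1,\dots,X_n)$ for $\star$ not a variable, and $**[p]=[p]$. In a sequent $X\vdash Y$ both structures have the same type. $S_-(X,Y)$ denotes $X\vdash Y$ and $S_+(X,Y)$ denotes $Y\vdash X$. The structure written $I$ is $[\top]$; "$X,Y$" is $[\wedge](X,Y)$ in an antecedent and $[\vee](X,Y)$ in a consequent. **$GGL_C$** has the rules (for all structures and formulas over $\mathcal L_C$): * dr1: from $S_{Æ(\star)}([\star](X_1,\dots,X_n),X_{n+1})$ infer $S_{Æ(\star')}([\star'](X_1,\dots,X_{n+1},\dots,X_n),X_j)$, where $\star'=(j\ n{+}1)\star$ and $X_{n+1}$ is in place $j$, for $\star\in\mathcal O(C)$; * dr2: from $S_s(X,Y)$ infer $S_{-s}(*X,*Y)$; * $\vdash\star$ ($\star\in C$): from $S_{Æ(\star)\pm_i(\star)}(X_i,\varphi_i)$ for all $i$ infer $S_{Æ(\star)}([\star](X_1,\dots,X_n),\star(\varphi_1,\dots,\varphi_n))$; * $\star\vdash$ ($\star\in C$): from $S_{Æ(\star)}([\star](\varphi_1,\dots,\varphi_n),U)$ infer $S_{Æ(\star)}(\star(\varphi_1,\dots,\varphi_n),U)$;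 * exchange $X,Y\vdash U\,/\,Y,X\vdash U$; weakening $X\vdash U\,/\,X,Y\vdash U$; contraction $X,X\vdash U\,/\,X\vdash U$; $X,I\vdash U\,/\,X\vdash U$; * $X,Y\vdash Z$ if and only if $X\vdash Z,*Y$ (a rule in each direction); * the structures $[\neg]X$ in antecedents and $[\neg']X$ in consequents are interchangeable with $*X$. **$AHL_C$** derives formulas of $\mathcal L_{\mathcal O(C)}$ (all formulas below are in $\mathcal L_{\mathcal O(C)}$, and $\star\in\mathcal O(C)$): * A0: $\top$ and $\neg\bot$; A1: $\varphi\to(\varphi\wedge\varphi)$; A2: $(\varphi\wedge\psi)\to\varphi$; A3: $(\varphi\to\psi)\to(\neg(\psi\wedge\rho)\to\neg(\rho\wedge\varphi))$; * A4: $\neg\star(\varphi_1,\dots,\varphi_n)\leftrightarrow-\star(\varphi_1,\dots,\varphi_n)$ for non-variable $\star$; * A7: $\star(\varphi_1,\dots,\star'(\varphi_1,\dots,\psi,\dots,\varphi_n),\dots,\varphi_n)\to\psi$ if $Æ(\star)=\exists$, where $\star'=(j\ n{+}1)\star$, the formula $\star'(\cdots)$ is in place $j$ of $\star$, and $\psi$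 is in place $j$ of $\star'$; A8: the converse implication if $Æ(\star)=\forall$; * R3: if $\pm_j(\star)=+$, from $\varphi_j\to\psi_j$ infer $\star(\dots,\varphi_j,\dots)\to\star(\dots,\psi_j,\dots)$; R4: if $\pm_j(\star)=-$, from $\psi_j\to\varphi_j$ infer the same; * MP: from $\varphi$ and $\varphi\to\psi$ infer $\psi$. Here $\varphi\leftrightarrow\psi$ is $(\varphi\to\psi)\wedge(\psi\to\varphi)$. **Translation.** The partial maps $\tau_\pm$ from structures over $\mathcal L_C$ to $\mathcal L_{\mathcal O(C)}$ are given by $\tau_\pm(\varphi)=\varphi$, $\tau_\pm(*\varphi)=\neg\varphi$, $\tau_s([\star](X_1,\dots,X_n))=\star(\tau_{s\pm_1(\star)}(X_1),\dots,\tau_{s\pm_n(\star)}(X_n))$ if $s=Æ(\star)$ (undefined if $s\neqÆ(\star)$), and $\tau_s(*[p])=\neg p$ if $s=-Æ(p)$ (undefined otherwise). **Theorem.** Let $C$ be a Boolean connective family, and let $X,Y$ be structures over $\mathcal L_C$ of the same type such that $\tau_-(X)$ and $\tau_+(Y)$ are defined. Then $X\vdash Y$ is derivable in $GGL_C$ if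 and only if $\tau_-(X)\to\tau_+(Y)$ is derivable in $AHL_C$. -/

import Mathlib

universe u

namespace AtomicLogic

/-! ## Skeletons and the two actions -/

/-- Signs, written additively: `0` is `+` and also `∀`; `1` is `-` and also `∃`. -/
abbrev Sgn := ZMod 2

/-- An `n`-ary connective skeleton: a permutation of the `n + 1` positions, a type tuple, a tonicity
signature (whose last entry is the semantic sign), and one more sign, the sum of the semantic sign
and the quantification sign. Positions `1, …, n + 1` are `Fin (n + 1)`, position `n + 1` being
`Fin.last n`. -/
@[ext]
structure Skeleton (n : ℕ) where
  perm : Equiv.Perm (Fin (n + 1))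
  typ : Fin (n + 1) → ℕ+
  ton : Fin (n + 1) → Sgn
  mode : Sgn

namespace Skeleton

variable {n : ℕ}

/-- The output type. -/
def out (c : Skeleton n) : ℕ+ := c.typ (Fin.last n)

/-- The quantification sign `Æ` (`1` is `∃`, `0` is `∀`). -/
def quant (c : Skeleton n) : Sgn := c.ton (Fin.last n) + c.mode

/-- The residuation action on tonicity signatures. -/
def resTon (σ : Equiv.Perm (Fin (n + 1))) (v : Fin (n + 1) → Sgn) (i : Fin (n + 1)) : Sgn :=
  if σ (Fin.last n) = Fin.last n then v (σ i)
  else if σ i = Fin.last n then v (σ (Fin.last n))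
  else 1 + v (σ (Fin.last n)) + v (Equiv.swap (Fin.last n) (σ (Fin.last n)) (σ i))

/-- The residuation action `α`. The product `σ · ρ` of permutations is `ρ ∘ σ`, so the new
permutation `σ · c.perm` is `c.perm ∘ σ`. -/
def res (σ : Equiv.Perm (Fin (n + 1))) (c : Skeleton n) : Skeleton n where
  perm := c.perm * σ
  typ := fun i => c.typ (σ i)
  ton := resTon σ c.ton
  mode := c.mode

/-- The Boolean negation action `β` (of the sign `-`). -/
def compl (c : Skeleton n) : Skeleton n where
  perm := c.perm
  typ := c.typ
  ton := fun i => 1 + c.ton i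
  mode := c.mode

/-- The residual `(j n+1) c`. -/
def resid (j : Fin n) (c : Skeleton n) : Skeleton n :=
  c.res (Equiv.swap j.castSucc (Fin.last n))

theorem resid_out (j : Fin n) (c : Skeleton n) : (c.resid j).out = c.typ j.castSucc := by
  simp [resid, res, out]

end Skeleton

/-! ## Connective families -/

/-- A connective family in which the non-variable connectives carry the action `α * β` and the
variables (certain propositional letters) the trivial action. Since the skeleton is injective on
each class `D` of the partition, a connective is a pair of a class `D` and a skeleton in `Mem D`. -/
structure Family where
  Cls : Type u
  arity : Cls → ℕ
  Mem : ∀ D, Set (Skeleton (arity D))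
  nonempty : ∀ D, (Mem D).Nonempty
  isVar : Cls → Bool
  arity_var : ∀ D, isVar D = true → arity D = 0
  typ_eq : ∀ D, ∀ c ∈ Mem D, ∀ c' ∈ Mem D, ∀ i, c'.typ i = c.typ (c.perm.symm (c'.perm i))

namespace Family

/-- A choice of connectives in each class. -/
abbrev Sub (C : Family.{u}) := ∀ D : C.Cls, Set (Skeleton (C.arity D))

/-- The orbit of the class `D`, that is, the structural connectives of the class `D`, or the
connectives of the class `D` in the full family `𝒪(C)`: for a non-variable class, the closure of the
class under `α` and `β`; for variables, only the variables themselves. -/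
inductive Orbit (C : Family.{u}) (D : C.Cls) : Skeleton (C.arity D) → Prop
  | base {c : Skeleton (C.arity D)} : c ∈ C.Mem D → Orbit C D c
  | res {c : Skeleton (C.arity D)} (hD : C.isVar D = false)
      (σ : Equiv.Perm (Fin (C.arity D + 1))) : Orbit C D c → Orbit C D (c.res σ)
  | compl {c : Skeleton (C.arity D)} (hD : C.isVar D = false) : Orbit C D c → Orbit C D c.compl

/-- The connectives of the full family `𝒪(C)`. -/
def full (C : Family.{u}) : C.Sub := fun D => {c | C.Orbit D c}

theorem isVar_false (C : Family.{u}) {D : C.Cls} (j : Fin (C.arity D)) : C.isVar D = false := by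
  by_contra h
  have h0 := C.arity_var D (by simpa using h)
  exact absurd j.2 (by omega)

theorem resid_mem_full {C : Family.{u}} {D : C.Cls} {c : Skeleton (C.arity D)}
    (h : c ∈ C.full D) (j : Fin (C.arity D)) : c.resid j ∈ C.full D :=
  Orbit.res (C.isVar_false j) _ h

theorem compl_mem_full {C : Family.{u}} {D : C.Cls} {c : Skeleton (C.arity D)}
    (h : c ∈ C.full D) (hD : C.isVar D = false) : c.compl ∈ C.full D :=
  Orbit.compl hD h

/-- The disjoint union of two families. -/
def sum (A B : Family.{u}) : Family.{u} where
  Cls := A.Cls ⊕ B.Cls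
  arity := fun D => match D with
    | .inl D => A.arity D
    | .inr D => B.arity D
  Mem := fun D => match D with
    | .inl D => A.Mem D
    | .inr D => B.Mem D
  nonempty := fun D => match D with
    | .inl D => A.nonempty D
    | .inr D => B.nonempty D
  isVar := fun D => match D with
    | .inl D => A.isVar D
    | .inr D => B.isVar D
  arity_var := fun D => match D with
    | .inl D => A.arity_var D
    | .inr D => B.arity_var D
  typ_eq := fun D => match D with
    | .inl D => A.typ_eq D
    | .inr D => B.typ_eq D

end Family

/-! ## Formulas and structures -/

/-- Formulas of each type whose connectives all belong to `M`. For `M = C.Mem` this is the language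
of `C`, for `M = C.full` the language of `𝒪(C)`. -/
inductive Formula (C : Family.{u}) (M : C.Sub) : ℕ+ → Type u
  | app {k : ℕ+} (D : C.Cls) (c : Skeleton (C.arity D)) (hc : c ∈ M D) (hk : c.out = k)
      (φ : ∀ i : Fin (C.arity D), Formula C M (c.typ i.castSucc)) : Formula C M k

/-- Structures over the formulas with connectives in `M`: a formula `φ`, a starred formula `*φ`,
`[⋆](X₁, …, Xₙ)` for a structural connective `[⋆]`, and `*[⋆](X₁, …, Xₙ)` for `[⋆]` not compatible
with `β`, that is, for variables. -/
inductive Struct (C : Family.{u}) (M : C.Sub) : ℕ+ → Type u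
  | form {k : ℕ+} (φ : Formula C M k) : Struct C M k
  | starForm {k : ℕ+} (φ : Formula C M k) : Struct C M k
  | app {k : ℕ+} (D : C.Cls) (c : Skeleton (C.arity D)) (hc : c ∈ C.full D) (hk : c.out = k)
      (X : ∀ i : Fin (C.arity D), Struct C M (c.typ i.castSucc)) : Struct C M k
  | starApp {k : ℕ+} (D : C.Cls) (hD : C.isVar D = true) (c : Skeleton (C.arity D))
      (hc : c ∈ C.full D) (hk : c.out = k)
      (X : ∀ i : Fin (C.arity D), Struct C M (c.typ i.castSucc)) : Struct C M k

/-- Boolean negation `*X` on structures: `**φ = φ`, `*[⋆](X₁, …, Xₙ) = [-⋆](X₁, …, Xₙ)` where `-⋆`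
exists, and `**[p] = [p]` for variables. -/
def Struct.star {C : Family.{u}} {M : C.Sub} {k : ℕ+} : Struct C M k → Struct C M k
  | .form φ => .starForm φ
  | .starForm φ => .form φ
  | .app D c hc hk X =>
      if hD : C.isVar D = true then .starApp D hD c hc hk X
      else .app D c.compl (Family.compl_mem_full hc (by simpa using hD)) hk X
  | .starApp D _ c hc hk X => .app D c hc hk X

/-- `X.Signed s` says that `X` lies in the domain of the translation `τ_s`: every structural
connective with quantification sign `∃` stands in an antecedent part and every one with quantification
sign `∀` in a consequent part, when `X` itself is an antecedent (`s = 1`) or a consequent (`s = 0`). -/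
def Struct.Signed {C : Family.{u}} {M : C.Sub} (s : Sgn) : ∀ {k : ℕ+}, Struct C M k → Prop
  | _, .form _ => True
  | _, .starForm _ => True
  | _, .app _ c _ _ X =>
      s = c.quant ∧ ∀ i, Struct.Signed (c.quant + c.ton i.castSucc) (X i)
  | _, .starApp _ _ c _ _ X =>
      s = c.quant + 1 ∧ ∀ i, Struct.Signed (c.quant + c.ton i.castSucc) (X i)

/-- A sequent `X ⊢ Y` of structures of the same type. -/
structure Sequent (C : Family.{u}) (M : C.Sub) where
  type : ℕ+
  ant : Struct C M type
  con : Struct C M type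

/-- `S_s(X, Y)`: it is `X ⊢ Y` for the sign `-` and `Y ⊢ X` for the sign `+`. -/
def seq {C : Family.{u}} {M : C.Sub} {k : ℕ+} (s : Sgn) (X Y : Struct C M k) : Sequent C M :=
  if s = 1 then ⟨k, X, Y⟩ else ⟨k, Y, X⟩

/-- `S_Æ([⋆], X₁, …, Xₙ, Xₙ₊₁)`, the structures being given as one tuple of length `n + 1`. -/
def seqConn {C : Family.{u}} {M : C.Sub} (D : C.Cls) (c : Skeleton (C.arity D)) (hc : c ∈ C.full D)
    (X : ∀ i : Fin (C.arity D + 1), Struct C M (c.typ i)) : Sequent C M :=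
  seq c.quant (.app D c hc rfl fun i => X i.castSucc) (X (Fin.last _))

/-! ## Boolean connective families -/

/-- `⊥ₖ`, with quantification sign `∀`. -/
def skBot (k : ℕ+) : Skeleton 0 := ⟨1, fun _ => k, ![0], 0⟩
/-- `⊤ₖ`, with quantification sign `∃`. -/
def skTop (k : ℕ+) : Skeleton 0 := ⟨1, fun _ => k, ![1], 0⟩
/-- `¬ₖ`, with quantification sign `∃`. -/
def skNot (k : ℕ+) : Skeleton 1 := ⟨1, fun _ => k, ![1, 0], 1⟩
/-- `∧ₖ`, with quantification sign `∃`. -/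
def skAnd (k : ℕ+) : Skeleton 2 := ⟨1, fun _ => k, ![0, 0, 0], 1⟩
/-- `∨ₖ`, with quantification sign `∀`. -/
def skOr (k : ℕ+) : Skeleton 2 := ⟨1, fun _ => k, ![0, 0, 1], 1⟩
/-- `→ₖ`, with quantification sign `∀`. -/
def skImp (k : ℕ+) : Skeleton 2 := ⟨Equiv.swap 1 2, fun _ => k, ![1, 0, 1], 1⟩
/-- `¬'ₖ`, the skeleton `¬ₖ` with the semantic sign switched; its quantification sign is `∀`. -/
def skNot' (k : ℕ+) : Skeleton 1 := ⟨1, fun _ => k, ![1, 1], 1⟩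

theorem skNot'_eq (k : ℕ+) :
    skNot' k = ((((skNot k).resid 0).compl).resid 0).compl := by
  ext i
  · simp [skNot', skNot, Skeleton.resid, Skeleton.compl, Skeleton.res]
  · simp [skNot', skNot, Skeleton.resid, Skeleton.compl, Skeleton.res]
  · fin_cases i <;> rfl
  · rfl

/-- The classes of the Boolean connectives: for each type `k` the classes `{⊥, ⊤}`, `{¬}` and
`{∧, ∨, →}`, and one class for each variable. -/
inductive BoolCls (V : Type u) : Type u
  | const (k : ℕ+)
  | neg (k : ℕ+)
  | bin (k : ℕ+)
  | var (v : V)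

/-- The family `B` of the Boolean connectives, with the variables in `V`. -/
def boolFamily (V : Type u) (sk : V → Skeleton 0) : Family.{u} where
  Cls := BoolCls V
  arity := fun D => match D with
    | .const _ => 0
    | .neg _ => 1
    | .bin _ => 2
    | .var _ => 0
  Mem := fun D => match D with
    | .const k => {skBot k, skTop k}
    | .neg k => {skNot k}
    | .bin k => {skAnd k, skOr k, skImp k}
    | .var v => {sk v}
  nonempty := fun D => match D with
    | .const k => ⟨skBot k, by simp⟩
    | .neg k => ⟨skNot k, by simp⟩
    | .bin k => ⟨skAnd k, by simp⟩
    | .var v => ⟨sk v, by simp⟩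
  isVar := fun D => match D with
    | .var _ => true
    | _ => false
  arity_var := fun D => match D with
    | .const _ => by simp
    | .neg _ => by simp
    | .bin _ => by simp
    | .var _ => by simp
  typ_eq := fun D => match D with
    | .const k => by
        rintro c (rfl | rfl) c' (rfl | rfl) i <;> rfl
    | .neg k => by
        rintro c rfl c' rfl i; rfl
    | .bin k => by
        rintro c (rfl | rfl | rfl) c' (rfl | rfl | rfl) i <;> rfl
    | .var v => by
        rintro c rfl c' rfl i; simp

/-- A Boolean connective family `B ⊔ C'`: the Boolean connectives, a set of variables with at least
one variable of each type and each tonicity, and an arbitrary connective family `C'`. -/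
structure BoolFamily where
  V : Type u
  sk : V → Skeleton 0
  exists_var : ∀ (k : ℕ+) (s : Sgn), ∃ v, (sk v).typ 0 = k ∧ (sk v).ton 0 = s
  rest : Family.{u}

namespace BoolFamily

/-- The underlying connective family `B ⊔ C'`. -/
def toFamily (C : BoolFamily.{u}) : Family.{u} := (boolFamily C.V C.sk).sum C.rest

variable (C : BoolFamily.{u}) (k : ℕ+)

/-- The class `{⊥, ⊤}` of type `k`. -/
abbrev clsConst : C.toFamily.Cls := Sum.inl (BoolCls.const k)
/-- The class `{¬}` of type `k`. -/
abbrev clsNot : C.toFamily.Cls := Sum.inl (BoolCls.neg k)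
/-- The class `{∧, ∨, →}` of type `k`. -/
abbrev clsBin : C.toFamily.Cls := Sum.inl (BoolCls.bin k)

theorem bot_mem : C.toFamily.Orbit (C.clsConst k) (skBot k) := .base (Or.inl rfl)
theorem top_mem : C.toFamily.Orbit (C.clsConst k) (skTop k) := .base (Or.inr rfl)
theorem not_mem : C.toFamily.Orbit (C.clsNot k) (skNot k) := .base rfl
theorem and_mem : C.toFamily.Orbit (C.clsBin k) (skAnd k) := .base (Or.inl rfl)
theorem or_mem : C.toFamily.Orbit (C.clsBin k) (skOr k) := .base (Or.inr (Or.inl rfl))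
theorem imp_mem : C.toFamily.Orbit (C.clsBin k) (skImp k) := .base (Or.inr (Or.inr rfl))
theorem not'_mem : C.toFamily.Orbit (C.clsNot k) (skNot' k) := by
  rw [skNot'_eq]
  exact .compl rfl (.res rfl _ (.compl rfl (.res rfl _ (C.not_mem k))))

/-- The language of `C`. -/
abbrev Fm (k : ℕ+) := Formula C.toFamily C.toFamily.Mem k
/-- The language of the full family `𝒪(C)`. -/
abbrev FullFm (k : ℕ+) := Formula C.toFamily C.toFamily.full k
/-- The structures of `C`. -/
abbrev Str (k : ℕ+) := Struct C.toFamily C.toFamily.Mem k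

variable {C k}

/-! ### Boolean connectives on formulas -/

def fBot : C.FullFm k := .app (C.clsConst k) (skBot k) (C.bot_mem k) rfl fun i => Fin.elim0 i
def fTop : C.FullFm k := .app (C.clsConst k) (skTop k) (C.top_mem k) rfl fun i => Fin.elim0 i
def fNot (φ : C.FullFm k) : C.FullFm k :=
  .app (C.clsNot k) (skNot k) (C.not_mem k) rfl fun _ => φ
def fAnd (φ ψ : C.FullFm k) : C.FullFm k :=
  .app (C.clsBin k) (skAnd k) (C.and_mem k) rfl (fun i : Fin 2 => ![φ, ψ] i)
def fImp (φ ψ : C.FullFm k) : C.FullFm k :=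
  .app (C.clsBin k) (skImp k) (C.imp_mem k) rfl (fun i : Fin 2 => ![φ, ψ] i)
def fIff (φ ψ : C.FullFm k) : C.FullFm k := fAnd (fImp φ ψ) (fImp ψ φ)

/-! ### Boolean structural connectives

The structure written `I` is `[⊤]` in an antecedent part, the structure written `X, Y` is `[∧](X, Y)`
in an antecedent part and `[∨](X, Y)` in a consequent part. -/

variable {M : C.toFamily.Sub}

def sI : Struct C.toFamily M k := .app (C.clsConst k) (skTop k) (C.top_mem k) rfl fun i => Fin.elim0 i
def sAnd (X Y : Struct C.toFamily M k) : Struct C.toFamily M k :=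
  .app (C.clsBin k) (skAnd k) (C.and_mem k) rfl (fun i : Fin 2 => ![X, Y] i)
def sOr (X Y : Struct C.toFamily M k) : Struct C.toFamily M k :=
  .app (C.clsBin k) (skOr k) (C.or_mem k) rfl (fun i : Fin 2 => ![X, Y] i)
def sNot (X : Struct C.toFamily M k) : Struct C.toFamily M k :=
  .app (C.clsNot k) (skNot k) (C.not_mem k) rfl fun _ => X
def sNot' (X : Struct C.toFamily M k) : Struct C.toFamily M k :=
  .app (C.clsNot k) (skNot' k) (C.not'_mem k) rfl fun _ => X

end BoolFamily

open BoolFamily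

/-! ## The display calculus -/

/-- Derivability in the display calculus with introduction rules for the connectives in `M`. -/
inductive Display (C : BoolFamily.{u}) (M : C.toFamily.Sub) (hM : ∀ D, M D ⊆ C.toFamily.full D) :
    Sequent C.toFamily M → Prop
  /-- Residuation: from `S_Æ([⋆], X₁, …, Xₙ₊₁)` infer `S_Æ((j n+1)[⋆], …)` with `Xⱼ` and `Xₙ₊₁`
  exchanged. -/
  | dr1 {D : C.toFamily.Cls} {c : Skeleton (C.toFamily.arity D)} (hc : c ∈ C.toFamily.full D)
      (j : Fin (C.toFamily.arity D))
      (X : ∀ i : Fin (C.toFamily.arity D + 1), Struct C.toFamily M (c.typ i)) :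
      Display C M hM (seqConn D c hc X) →
      Display C M hM (seqConn D (c.resid j) (Family.resid_mem_full hc j)
        fun i => X (Equiv.swap j.castSucc (Fin.last _) i))
  /-- Negation: from `S_s(X, Y)` infer `S_{-s}(*X, *Y)`. -/
  | dr2 {k : ℕ+} (s : Sgn) (X Y : Struct C.toFamily M k) :
      Display C M hM (seq s X Y) → Display C M hM (seq (s + 1) X.star Y.star)
  /-- The rule `⊢ ⋆`. -/
  | conn_right {D : C.toFamily.Cls} {c : Skeleton (C.toFamily.arity D)} (hc : c ∈ M D)
      (X : ∀ i : Fin (C.toFamily.arity D), Struct C.toFamily M (c.typ i.castSucc))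
      (φ : ∀ i : Fin (C.toFamily.arity D), Formula C.toFamily M (c.typ i.castSucc)) :
      (∀ i, Display C M hM (seq (c.quant + c.ton i.castSucc) (X i) (.form (φ i)))) →
      Display C M hM (seq c.quant (.app D c (hM D hc) rfl X) (.form (.app D c hc rfl φ)))
  /-- The rule `⋆ ⊢`. -/
  | conn_left {D : C.toFamily.Cls} {c : Skeleton (C.toFamily.arity D)} (hc : c ∈ M D)
      (φ : ∀ i : Fin (C.toFamily.arity D), Formula C.toFamily M (c.typ i.castSucc))
      (U : Struct C.toFamily M c.out) :
      Display C M hM (seq c.quant (.app D c (hM D hc) rfl fun i => .form (φ i)) U) →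
      Display C M hM (seq c.quant (.form (.app D c hc rfl φ)) U)
  /-- Exchange. -/
  | ci {k : ℕ+} (X Y U : Struct C.toFamily M k) :
      Display C M hM ⟨k, sAnd X Y, U⟩ → Display C M hM ⟨k, sAnd Y X, U⟩
  /-- Weakening. -/
  | weak {k : ℕ+} (X Y U : Struct C.toFamily M k) :
      Display C M hM ⟨k, X, U⟩ → Display C M hM ⟨k, sAnd X Y, U⟩
  /-- Contraction. -/
  | wi {k : ℕ+} (X U : Struct C.toFamily M k) :
      Display C M hM ⟨k, sAnd X X, U⟩ → Display C M hM ⟨k, X, U⟩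
  /-- Elimination of `I`. -/
  | iwi {k : ℕ+} (X U : Struct C.toFamily M k) :
      Display C M hM ⟨k, sAnd X sI, U⟩ → Display C M hM ⟨k, X, U⟩
  /-- From `X, Y ⊢ Z` infer `X ⊢ Z, *Y`, and conversely. -/
  | shift {k : ℕ+} (X Y Z : Struct C.toFamily M k) :
      Display C M hM ⟨k, sAnd X Y, Z⟩ → Display C M hM ⟨k, X, sOr Z Y.star⟩
  | shift_inv {k : ℕ+} (X Y Z : Struct C.toFamily M k) :
      Display C M hM ⟨k, X, sOr Z Y.star⟩ → Display C M hM ⟨k, sAnd X Y, Z⟩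
  /-- The identification of `[¬]` (in antecedents) and `[¬']` (in consequents) with `*`; displaying a
  substructure makes it available at every depth. -/
  | not_star {k : ℕ+} (X U : Struct C.toFamily M k) :
      Display C M hM ⟨k, sNot X, U⟩ → Display C M hM ⟨k, X.star, U⟩
  | star_not {k : ℕ+} (X U : Struct C.toFamily M k) :
      Display C M hM ⟨k, X.star, U⟩ → Display C M hM ⟨k, sNot X, U⟩
  | not'_star {k : ℕ+} (X U : Struct C.toFamily M k) :
      Display C M hM ⟨k, U, sNot' X⟩ → Display C M hM ⟨k, U, X.star⟩
  | star_not' {k : ℕ+} (X U : Struct C.toFamily M k) :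
      Display C M hM ⟨k, U, X.star⟩ → Display C M hM ⟨k, U, sNot' X⟩

theorem mem_subset_full (C : Family.{u}) (D : C.Cls) : C.Mem D ⊆ C.full D :=
  fun _ h => Family.Orbit.base h

/-- Derivability of the sequent `X ⊢ Y` in the display calculus `GGL_C`. -/
def GGL (C : BoolFamily.{u}) {k : ℕ+} (X Y : C.Str k) : Prop :=
  Display C C.toFamily.Mem (mem_subset_full C.toFamily) ⟨k, X, Y⟩

/-! ## The Hilbert calculus -/

/-- Derivability in the Hilbert calculus `AHL_C`. Its axioms mention `-⋆` and `(j n+1)⋆`, so formulas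
and connectives range over the full family `𝒪(C)`. -/
inductive AHL (C : BoolFamily.{u}) : ∀ {k : ℕ+}, C.FullFm k → Prop
  | a0 {k : ℕ+} : AHL C (fTop : C.FullFm k)
  | a0' {k : ℕ+} : AHL C (fNot fBot : C.FullFm k)
  | a1 {k : ℕ+} (φ : C.FullFm k) : AHL C (fImp φ (fAnd φ φ))
  | a2 {k : ℕ+} (φ ψ : C.FullFm k) : AHL C (fImp (fAnd φ ψ) φ)
  | a3 {k : ℕ+} (φ ψ ρ : C.FullFm k) :
      AHL C (fImp (fImp φ ψ) (fImp (fNot (fAnd ψ ρ)) (fNot (fAnd ρ φ))))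
  /-- `¬⋆(φ₁, …, φₙ) ↔ -⋆(φ₁, …, φₙ)` for non-variable `⋆`. -/
  | a4 {D : C.toFamily.Cls} {c : Skeleton (C.toFamily.arity D)} (hc : c ∈ C.toFamily.full D)
      (hD : C.toFamily.isVar D = false)
      (φ : ∀ i : Fin (C.toFamily.arity D), C.FullFm (c.typ i.castSucc)) :
      AHL C (fIff (fNot (.app D c hc rfl φ))
        (.app D c.compl (Family.compl_mem_full hc hD) rfl φ))
  /-- `⋆(φ₁, …, (j n+1)⋆(φ₁, …, φₙ), …, φₙ) → φⱼ` if `Æ(⋆) = ∃`. As `φⱼ` has the output type of `⋆`,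
  it is the last entry of the tuple `φ`, whose entry at `j` is not used. -/
  | a7 {D : C.toFamily.Cls} {c : Skeleton (C.toFamily.arity D)} (hc : c ∈ C.toFamily.full D)
      (j : Fin (C.toFamily.arity D))
      (φ : ∀ i : Fin (C.toFamily.arity D + 1), C.FullFm (c.typ i)) (hq : c.quant = 1) :
      AHL C (fImp
        (.app D c hc rfl (Function.update (fun i => φ i.castSucc) j
          (.app D (c.resid j) (Family.resid_mem_full hc j) (c.resid_out j)
            fun i => φ (Equiv.swap j.castSucc (Fin.last _) i.castSucc))))
        (φ (Fin.last _)))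
  /-- `φⱼ → ⋆(φ₁, …, (j n+1)⋆(φ₁, …, φₙ), …, φₙ)` if `Æ(⋆) = ∀`. -/
  | a8 {D : C.toFamily.Cls} {c : Skeleton (C.toFamily.arity D)} (hc : c ∈ C.toFamily.full D)
      (j : Fin (C.toFamily.arity D))
      (φ : ∀ i : Fin (C.toFamily.arity D + 1), C.FullFm (c.typ i)) (hq : c.quant = 0) :
      AHL C (fImp
        (φ (Fin.last _))
        (.app D c hc rfl (Function.update (fun i => φ i.castSucc) j
          (.app D (c.resid j) (Family.resid_mem_full hc j) (c.resid_out j)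
            fun i => φ (Equiv.swap j.castSucc (Fin.last _) i.castSucc)))))
  /-- Monotonicity in the components of tonicity `+`. -/
  | r3 {D : C.toFamily.Cls} {c : Skeleton (C.toFamily.arity D)} (hc : c ∈ C.toFamily.full D)
      (j : Fin (C.toFamily.arity D))
      (φ : ∀ i : Fin (C.toFamily.arity D), C.FullFm (c.typ i.castSucc))
      (ψ : C.FullFm (c.typ j.castSucc)) (hj : c.ton j.castSucc = 0) :
      AHL C (fImp (φ j) ψ) →
      AHL C (fImp (.app D c hc rfl φ) (.app D c hc rfl (Function.update φ j ψ)) :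
        C.FullFm c.out)
  /-- Antitonicity in the components of tonicity `-`. -/
  | r4 {D : C.toFamily.Cls} {c : Skeleton (C.toFamily.arity D)} (hc : c ∈ C.toFamily.full D)
      (j : Fin (C.toFamily.arity D))
      (φ : ∀ i : Fin (C.toFamily.arity D), C.FullFm (c.typ i.castSucc))
      (ψ : C.FullFm (c.typ j.castSucc)) (hj : c.ton j.castSucc = 1) :
      AHL C (fImp ψ (φ j)) →
      AHL C (fImp (.app D c hc rfl φ) (.app D c hc rfl (Function.update φ j ψ)) :
        C.FullFm c.out)
  | mp {k : ℕ+} (φ ψ : C.FullFm k) : AHL C φ → AHL C (fImp φ ψ) → AHL C ψ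

/-! ## The translation -/

/-- The inclusion of the language of `C` in that of `𝒪(C)`. -/
def Formula.incl {C : Family.{u}} : ∀ {k : ℕ+}, Formula C C.Mem k → Formula C C.full k
  | _, .app D c hc hk φ => .app D c (mem_subset_full C D hc) hk fun i => (φ i).incl

/-- The translation `τ` of structures into formulas: each structural connective becomes the
connective, and `*` becomes `¬`. For each sign `s`, the partial translation `τ_s` is the restriction
of `τ` to the structures `X` with `X.Signed s`. -/
def tau {C : BoolFamily.{u}} : ∀ {k : ℕ+}, C.Str k → C.FullFm k
  | _, .form φ => φ.incl
  | _, .starForm φ => fNot φ.incl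
  | _, .app D c hc hk X => .app D c hc hk fun i => tau (X i)
  | _, .starApp D _ c hc hk X => fNot (.app D c hc hk fun i => tau (X i))

end AtomicLogic

/-! From display to Hilbert the proof is an induction on derivations (`provable_of_display`).
Residuation leaves every structure on its side, and `*` reverses side and quantification sign
together, so whenever the translation of a conclusion is defined, the translations of the premises
are defined too. It remains to see that each rule preserves provable implications. For dr1 this is
the residuation law `leConn_resid`, drawn from A7, A8 and monotonicity; for dr2 it is A4. The
delicate point is that A4 is a conjunction of implications, while A2 projects only to the left and
A3 commutes only negated conjunctions. The right conjunct is recovered in `valid_of_valid_fAnd`;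
double negation and commutativity of `∧` come after it.

The display calculus has no cut rule with which to imitate modus ponens, so the converse is
semantic. Each formula is interpreted by a pair consisting of a set of antecedents and a set of
consequents, each the orthogonal of the other under derivability. Every theorem of the Hilbert
calculus receives all structures as antecedents (`AHL.valid`), modus ponens becoming an inclusion of
sets. The rules `⊢ ⋆` and `⋆ ⊢` say exactly that a formula belongs to both sets of its own
interpretation (`mem_interp_incl`), and the same holds for a structure and its translation on the
side where the latter is defined (`mem_interp_tau`). If `τ(X) → τ(Y)` is provable, then `X` is an
antecedent of `τ(Y)`; as `Y` is a consequent of it, `X ⊢ Y` is derivable. -/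

namespace AtomicLogic

/-! ### Signs, sides and the involutions on skeletons. -/

namespace Skeleton

variable {n : ℕ}

theorem sgn_cases : ∀ s : Sgn, s = 0 ∨ s = 1 := by decide

theorem sgn_add_one_add_one (s : Sgn) : s + 1 + 1 = s := by revert s; decide

theorem sgn_add_one_ne (s : Sgn) : s + 1 ≠ s := by revert s; decide

theorem sgn_ne {s t : Sgn} (h : t ≠ s) : t = s + 1 := by revert s t; decide

theorem compl_compl (c : Skeleton n) : c.compl.compl = c := by
  ext i
  · rfl
  · rfl
  · show 1 + (1 + c.ton i) = c.ton i
    generalize c.ton i = s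
    revert s; decide
  · rfl

theorem quant_compl (c : Skeleton n) : c.compl.quant = c.quant + 1 := by
  simp only [quant, compl]; ring

theorem ton_resid_self (c : Skeleton n) (j : Fin n) :
    (c.resid j).ton j.castSucc = c.ton j.castSucc := by
  simp [resid, res, resTon, (Fin.castSucc_lt_last j).ne]

theorem ton_resid_last (c : Skeleton n) (j : Fin n) :
    (c.resid j).ton (Fin.last n) = 1 + c.ton j.castSucc + c.ton (Fin.last n) := by
  simp [resid, res, resTon, (Fin.castSucc_lt_last j).ne]

theorem ton_resid_of_ne (c : Skeleton n) {i j : Fin n} (h : i ≠ j) :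
    (c.resid j).ton i.castSucc = 1 + c.ton j.castSucc + c.ton i.castSucc := by
  have h₁ : i.castSucc ≠ j.castSucc := fun e => h (Fin.castSucc_injective _ e)
  have h₂ : i.castSucc ≠ Fin.last n := (Fin.castSucc_lt_last i).ne
  simp [resid, res, resTon, (Fin.castSucc_lt_last j).ne, Equiv.swap_apply_of_ne_of_ne h₁ h₂,
    Equiv.swap_apply_of_ne_of_ne h₂ h₁, h₂]

/-- On signs the reason is that adding `1 + s` twice does nothing. This makes the rule dr1
invertible. -/
theorem resid_resid (c : Skeleton n) (j : Fin n) : (c.resid j).resid j = c := by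
  ext i
  · simp [resid, res]
  · simp [resid, res]
  · induction i using Fin.lastCases with
    | last =>
      rw [ton_resid_last, ton_resid_self, ton_resid_last]
      generalize c.ton _ = s
      generalize c.ton _ = t
      revert s t; decide
    | cast i =>
      by_cases h : i = j
      · subst h; rw [ton_resid_self, ton_resid_self]
      · rw [ton_resid_of_ne _ h, ton_resid_self, ton_resid_of_ne _ h]
        generalize c.ton _ = s
        generalize c.ton _ = t
        revert s t; decide
  · rfl

/-- The side (`1` for antecedent) on which the entry `i` of the sequent
`S_Æ([c](X₁, …, Xₙ), Xₙ₊₁)` stands. -/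
def side (c : Skeleton n) (i : Fin (n + 1)) : Sgn :=
  if i = Fin.last n then c.quant + 1 else c.quant + c.ton i

theorem side_last (c : Skeleton n) : c.side (Fin.last n) = c.quant + 1 := if_pos rfl

theorem side_castSucc (c : Skeleton n) (i : Fin n) :
    c.side i.castSucc = c.quant + c.ton i.castSucc := if_neg (Fin.castSucc_lt_last i).ne

theorem quant_resid (c : Skeleton n) (j : Fin n) :
    (c.resid j).quant = c.side j.castSucc + 1 := by
  rw [side_castSucc, quant, ton_resid_last]
  show _ + c.mode = c.ton _ + c.mode + _ + 1
  ring

/-- Residuation permutes the entries of a sequent, and each entry stays in an antecedent or in a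
consequent part as before. Hence dr1 preserves both the domain of the translation and membership in
polar pairs. -/
theorem side_resid (c : Skeleton n) (j : Fin n) (i : Fin (n + 1)) :
    (c.resid j).side i = c.side (Equiv.swap j.castSucc (Fin.last n) i) := by
  induction i using Fin.lastCases with
  | last =>
    rw [side_last, Equiv.swap_apply_right, quant_resid, sgn_add_one_add_one]
  | cast i =>
    by_cases h : i = j
    · subst h
      rw [side_castSucc, Equiv.swap_apply_left, side_last, quant_resid, side_castSucc,
        ton_resid_self]
      generalize c.ton _ = s
      generalize c.quant = t
      revert s t; decide
    · have h₁ : i.castSucc ≠ j.castSucc := fun e => h (Fin.castSucc_injective _ e)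
      rw [Equiv.swap_apply_of_ne_of_ne h₁ (Fin.castSucc_lt_last i).ne, side_castSucc,
        quant_resid, side_castSucc, side_castSucc, ton_resid_of_ne _ h]
      generalize c.ton _ = s
      generalize c.ton _ = s'
      generalize c.quant = t
      revert s s' t; decide

/-- Negation switches the quantification sign and the tonicity; the two changes cancel in their sum.
-/
theorem side_compl (c : Skeleton n) (i : Fin n) :
    c.compl.side i.castSucc = c.side i.castSucc := by
  rw [side_castSucc, side_castSucc, quant_compl]
  show c.quant + 1 + (1 + c.ton i.castSucc) = _
  generalize c.ton _ = s
  generalize c.quant = t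
  revert s t; decide

end Skeleton

open Skeleton BoolFamily

variable {C : BoolFamily.{u}}

/-! ## Derivability in the display calculus -/

/-- `S_s(X, Y)` is derivable in `GGL_C`. -/
def Dv {k : ℕ+} (s : Sgn) (X Y : C.Str k) : Prop :=
  Display C C.toFamily.Mem (mem_subset_full C.toFamily) (seq s X Y)

theorem seq_swap {F : Family.{u}} {M : F.Sub} {k : ℕ+} (s : Sgn) (X Y : Struct F M k) :
    seq (s + 1) Y X = seq s X Y := by
  rcases sgn_cases s with rfl | rfl
  · rfl
  · rfl

theorem dv_swap {k : ℕ+} {s : Sgn} {X Y : C.Str k} : Dv (s + 1) Y X ↔ Dv s X Y := by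
  rw [Dv, seq_swap, Dv]

theorem Struct.star_star {F : Family.{u}} {M : F.Sub} {k : ℕ+} (X : Struct F M k) :
    X.star.star = X := by
  cases X with
  | form φ => rfl
  | starForm φ => rfl
  | app D c hc hk X =>
    by_cases hD : F.isVar D = true
    · simp [Struct.star, hD]
    · subst hk
      -- The equation `-(-c) = c` is not definitional and the types of the arguments depend on the
      -- skeleton, so it is generalised before substitution.
      have : ∀ c' (h : c' = c) (hc' : c' ∈ F.full D) (hk : c'.out = c.out)
          (X' : ∀ i : Fin (F.arity D), Struct F M (c'.typ i.castSucc)) (_ : HEq X' X),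
          Struct.app D c' hc' hk X' = Struct.app D c hc rfl X := by
        rintro c' rfl hc' hk X' h
        rw [eq_of_heq h]
      simp only [Struct.star, hD, Bool.false_eq_true, dite_false]
      exact this _ c.compl_compl _ _ _ HEq.rfl
  | starApp D hD c hc hk X => simp [Struct.star, hD]

theorem Struct.star_app {F : Family.{u}} {M : F.Sub} {k : ℕ+} {D : F.Cls}
    {c : Skeleton (F.arity D)} {hc : c ∈ F.full D} {hk : c.out = k} (hD : F.isVar D = false)
    (X : ∀ i : Fin (F.arity D), Struct F M (c.typ i.castSucc)) :
    (Struct.app D c hc hk X).star = .app D c.compl (Family.compl_mem_full hc hD) hk X := by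
  simp only [Struct.star, hD]
  rfl

theorem dv_star {k : ℕ+} {s : Sgn} {X Y : C.Str k} : Dv (s + 1) X.star Y.star ↔ Dv s X Y := by
  refine ⟨fun h => ?_, fun h => .dr2 s X Y h⟩
  have := Display.dr2 _ _ _ h
  rwa [Struct.star_star, Struct.star_star, sgn_add_one_add_one] at this

theorem dv_star_comm {k : ℕ+} {s : Sgn} {X Y : C.Str k} : Dv s X.star Y ↔ Dv s Y.star X := by
  rw [← dv_star, Struct.star_star, dv_swap]

theorem dv_star_comm' {k : ℕ+} {s : Sgn} {X Y : C.Str k} : Dv s X Y.star ↔ Dv s Y X.star := by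
  rw [← dv_star, Struct.star_star, dv_swap]

theorem seqConn_congr {F : Family.{u}} {M : F.Sub} {D : F.Cls} {c c' : Skeleton (F.arity D)}
    (h : c = c') {hc : c ∈ F.full D} {hc' : c' ∈ F.full D}
    {X : ∀ i : Fin (F.arity D + 1), Struct F M (c.typ i)}
    {X' : ∀ i : Fin (F.arity D + 1), Struct F M (c'.typ i)} (hX : ∀ i, HEq (X i) (X' i)) :
    seqConn D c hc X = seqConn D c' hc' X' := by
  subst h
  rw [funext fun i => eq_of_heq (hX i)]

theorem display_dr1_iff {D : C.toFamily.Cls} {c : Skeleton (C.toFamily.arity D)}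
    (hc : c ∈ C.toFamily.full D) (j : Fin (C.toFamily.arity D))
    (X : ∀ i : Fin (C.toFamily.arity D + 1), C.Str (c.typ i)) :
    Display C C.toFamily.Mem (mem_subset_full C.toFamily) (seqConn D c hc X) ↔
      Display C C.toFamily.Mem (mem_subset_full C.toFamily)
        (seqConn D (c.resid j) (Family.resid_mem_full hc j)
          fun i => X (Equiv.swap j.castSucc (Fin.last _) i)) := by
  refine ⟨fun h => .dr1 hc j X h, fun h => ?_⟩
  refine seqConn_congr (c.resid_resid j) (fun i => ?_) ▸ Display.dr1 _ j _ h
  exact congr_arg_heq X (Equiv.swap_apply_self _ _ i)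

/-! ### Switching the tonicity of a single place. -/

namespace Skeleton

/-- The skeleton with the tonicity of the `j`-th place switched. -/
def flip {n : ℕ} (j : Fin n) (c : Skeleton n) : Skeleton n where
  perm := c.perm
  typ := c.typ
  ton := fun i => if i = j.castSucc then 1 + c.ton i else c.ton i
  mode := c.mode

/-- Residuation brings place `j` to the output, where negation acts on it, and then brings it back.
At the other places the shifts cancel in pairs. -/
theorem resid_compl_resid {n : ℕ} (j : Fin n) (c : Skeleton n) :
    ((c.resid j).compl).resid j = c.flip j := by
  ext i
  · simp [resid, res, flip, compl]
  · simp [resid, res, flip, compl]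
  · induction i using Fin.lastCases with
    | last =>
      rw [ton_resid_last]
      simp only [compl, flip, (Fin.castSucc_lt_last j).ne', if_false]
      rw [ton_resid_last, ton_resid_self]
      generalize c.ton _ = s
      generalize c.ton _ = t
      revert s t; decide
    | cast i =>
      by_cases h : i = j
      · subst h
        rw [ton_resid_self]
        simp only [compl, flip, if_true]
        rw [ton_resid_self]
      · have h₁ : i.castSucc ≠ j.castSucc := fun e => h (Fin.castSucc_injective _ e)
        rw [ton_resid_of_ne _ h]
        simp only [compl, flip, h₁, if_false]
        rw [ton_resid_self, ton_resid_of_ne _ h]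
        generalize c.ton _ = s
        generalize c.ton _ = t
        revert s t; decide
  · rfl

theorem skImp_eq (k : ℕ+) : skImp k = (skAnd k).resid 1 := by
  ext i
  · simp [skImp, skAnd, resid, res]
  · rfl
  · fin_cases i <;> rfl
  · rfl

/-- De Morgan's law at the level of skeletons: negate the output and both arguments. -/
theorem skAnd_eq (k : ℕ+) : skAnd k = ((skOr k).compl.flip 0).flip 1 := by
  ext i
  · rfl
  · rfl
  · revert i; simp only [skAnd, skOr, flip, compl]; decide
  · rfl

theorem skNot'_compl_flip (k : ℕ+) : skNot k = (skNot' k).compl.flip 0 := by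
  ext i
  · rfl
  · rfl
  · revert i; simp only [skNot, skNot', flip, compl]; decide
  · rfl

theorem side_skNot (k : ℕ+) : (skNot k).quant + (skNot k).ton (Fin.castSucc 0) = 0 := by
  simp [skNot, quant]; decide

theorem side_skImp_zero (k : ℕ+) : (skImp k).quant + (skImp k).ton (Fin.castSucc 0) = 1 := by
  simp [skImp, quant]; decide

theorem side_skImp_one (k : ℕ+) : (skImp k).quant + (skImp k).ton (Fin.castSucc 1) = 0 := by
  simp [skImp, quant]; decide

theorem compl_skBot (k : ℕ+) : (skBot k).compl = skTop k := by
  ext i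
  · rfl
  · rfl
  · fin_cases i; rfl
  · rfl

end Skeleton

theorem Family.flip_mem_full {F : Family.{u}} {D : F.Cls} {c : Skeleton (F.arity D)}
    (h : c ∈ F.full D) (j : Fin (F.arity D)) : c.flip j ∈ F.full D := by
  rw [← resid_compl_resid]
  exact resid_mem_full (compl_mem_full (resid_mem_full h j) (F.isVar_false j)) j

/-- The tuple `x` with `st` applied to its entry at `m`. -/
def starAt {n : ℕ} {t : Fin n → ℕ+} {T : ℕ+ → Type*} (st : ∀ {k}, T k → T k) (m : Fin n)
    (x : ∀ i, T (t i)) (i : Fin n) : T (t i) :=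
  if i = m then st (x i) else x i

/-! ### De Morgan laws and residuation for abstract relations on tuples. -/

section DisplayRelation

variable {F : Family.{u}} {D : F.Cls} {T : ℕ+ → Type*} {st : ∀ {k}, T k → T k}
  {P : ∀ c : Skeleton (F.arity D), c ∈ F.full D → (∀ i, T (c.typ i)) → Prop}

theorem rel_congr {c c' : Skeleton (F.arity D)} (h : c = c') {hc : c ∈ F.full D}
    {hc' : c' ∈ F.full D} {x : ∀ i, T (c.typ i)} {x' : ∀ i, T (c'.typ i)}
    (hx : ∀ i, HEq (x i) (x' i)) : P c hc x ↔ P c' hc' x' := by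
  subst h
  rw [funext fun i => eq_of_heq (hx i)]

/-- A relation on tuples that respects residuals and negations of connectives also respects the
switch of the tonicity of one place. -/
theorem rel_flip
    (hres : ∀ (c : Skeleton (F.arity D)) (hc : c ∈ F.full D) (j : Fin (F.arity D))
      (x : ∀ i, T (c.typ i)), P c hc x ↔ P (c.resid j) (Family.resid_mem_full hc j)
        fun i => x (Equiv.swap j.castSucc (Fin.last _) i))
    (hcompl : ∀ (c : Skeleton (F.arity D)) (hc : c ∈ F.full D) (hD : F.isVar D = false)
      (x : ∀ i, T (c.typ i)), P c hc x ↔ P c.compl (Family.compl_mem_full hc hD)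
        (starAt st (Fin.last _) x))
    {c : Skeleton (F.arity D)} (hc : c ∈ F.full D) (j : Fin (F.arity D)) (x : ∀ i, T (c.typ i)) :
    P c hc x ↔ P (c.flip j) (Family.flip_mem_full hc j) (starAt st j.castSucc x) := by
  refine (hres c hc j x).trans ((hcompl _ _ (F.isVar_false j) _).trans ((hres _ _ j _).trans ?_))
  refine rel_congr (c.resid_compl_resid j) fun i => ?_
  by_cases h : i = j.castSucc
  · have h' : Equiv.swap j.castSucc (Fin.last _) i = Fin.last _ := by
      rw [h, Equiv.swap_apply_left]
    exact (heq_of_eq (if_pos h')).trans ((congr_arg_heq (fun i => st (x i))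
      (Equiv.swap_apply_self _ _ i)).trans (heq_of_eq (if_pos h).symm))
  · have h' : Equiv.swap j.castSucc (Fin.last _) i ≠ Fin.last _ := by
      rw [Ne, Equiv.swap_apply_eq_iff, Equiv.swap_apply_right]; exact h
    exact (heq_of_eq (if_neg h')).trans ((congr_arg_heq x
      (Equiv.swap_apply_self _ _ i)).trans (heq_of_eq (if_neg h).symm))

end DisplayRelation

section BooleanDisplayRelation

variable {T : ℕ+ → Type*} {st : ∀ {k}, T k → T k} {k : ℕ+}

/-- Stated for an arbitrary relation because it is used twice: for derivability of sequents with
`*`, and for provable implication with `¬`. -/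
theorem rel_or_iff
    {P : ∀ c : Skeleton (C.toFamily.arity (C.clsBin k)), c ∈ C.toFamily.full (C.clsBin k) →
      (∀ i, T (c.typ i)) → Prop}
    (hres : ∀ c hc (j : Fin 2) x, P c hc x ↔ P (c.resid j) (Family.resid_mem_full hc j)
        fun i => x (Equiv.swap j.castSucc (Fin.last _) i))
    (hcompl : ∀ c hc hD x, P c hc x ↔ P c.compl (Family.compl_mem_full hc hD)
        (starAt st (Fin.last _) x)) (y z x : T k) :
    P (skOr k) (C.or_mem k) (fun i : Fin 3 => ![y, z, x] i) ↔
      P (skAnd k) (C.and_mem k) (fun i : Fin 3 => ![st y, st z, st x] i) := by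
  refine (hcompl _ _ rfl _).trans ((rel_flip hres hcompl _ (0 : Fin 2) _).trans
    ((rel_flip hres hcompl _ (1 : Fin 2) _).trans ?_))
  refine (rel_congr (skAnd_eq k) fun i => ?_).symm
  change Fin 3 at i
  fin_cases i <;> rfl

theorem rel_not'_iff
    {P : ∀ c : Skeleton (C.toFamily.arity (C.clsNot k)), c ∈ C.toFamily.full (C.clsNot k) →
      (∀ i, T (c.typ i)) → Prop}
    (hres : ∀ c hc (j : Fin 1) x, P c hc x ↔ P (c.resid j) (Family.resid_mem_full hc j)
        fun i => x (Equiv.swap j.castSucc (Fin.last _) i))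
    (hcompl : ∀ c hc hD x, P c hc x ↔ P c.compl (Family.compl_mem_full hc hD)
        (starAt st (Fin.last _) x)) (y x : T k) :
    P (skNot' k) (C.not'_mem k) (fun i : Fin 2 => ![y, x] i) ↔
      P (skNot k) (C.not_mem k) (fun i : Fin 2 => ![st y, st x] i) := by
  refine (hcompl _ _ rfl _).trans ((rel_flip hres hcompl _ (0 : Fin 1) _).trans ?_)
  refine (rel_congr (skNot'_compl_flip k) fun i => ?_).symm
  change Fin 2 at i
  fin_cases i <;> rfl

theorem rel_imp_iff
    {P : ∀ c : Skeleton (C.toFamily.arity (C.clsBin k)), c ∈ C.toFamily.full (C.clsBin k) →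
      (∀ i, T (c.typ i)) → Prop}
    (hres : ∀ c hc (j : Fin 2) x, P c hc x ↔ P (c.resid j) (Family.resid_mem_full hc j)
        fun i => x (Equiv.swap j.castSucc (Fin.last _) i)) (y z x : T k) :
    P (skImp k) (C.imp_mem k) (fun i : Fin 3 => ![y, z, x] i) ↔
      P (skAnd k) (C.and_mem k) (fun i : Fin 3 => ![y, x, z] i) := by
  refine Iff.trans ?_ (hres (skAnd k) _ 1 _).symm
  refine rel_congr (F := C.toFamily) (D := C.clsBin k) (skImp_eq k) fun i => ?_
  change Fin 3 at i
  fin_cases i <;> rfl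

end BooleanDisplayRelation

/-! ## Boolean reasoning in the display calculus -/

theorem dv_app_compl {D : C.toFamily.Cls} {c : Skeleton (C.toFamily.arity D)}
    (hc : c ∈ C.toFamily.full D) (hD : C.toFamily.isVar D = false)
    (X : ∀ i : Fin (C.toFamily.arity D), C.Str (c.typ i.castSucc)) (U : C.Str c.out) :
    Dv c.compl.quant (.app D c.compl (Family.compl_mem_full hc hD) rfl X) U.star ↔
      Dv c.quant (.app D c hc rfl X) U := by
  rw [← dv_star, Struct.star_app hD, quant_compl]
  rfl

theorem display_compl_iff {D : C.toFamily.Cls} (c : Skeleton (C.toFamily.arity D))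
    (hc : c ∈ C.toFamily.full D) (hD : C.toFamily.isVar D = false)
    (X : ∀ i, C.Str (c.typ i)) :
    Display C C.toFamily.Mem (mem_subset_full C.toFamily) (seqConn D c hc X) ↔
      Display C C.toFamily.Mem (mem_subset_full C.toFamily)
        (seqConn D c.compl (Family.compl_mem_full hc hD) (starAt (T := C.Str) Struct.star (Fin.last _) X)) := by
  let W : ∀ i, C.Str (c.typ i) := starAt (T := C.Str) Struct.star (Fin.last _) X
  have h₁ : (fun i : Fin (C.toFamily.arity D) => W i.castSucc) = fun i : Fin _ => X i.castSucc :=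
    funext fun i => if_neg (Fin.castSucc_lt_last i).ne
  have h₂ : W (Fin.last _) = (X (Fin.last _)).star := if_pos rfl
  unfold seqConn
  change _ ↔ Dv c.compl.quant (.app D c.compl (Family.compl_mem_full hc hD) rfl
    (fun i : Fin (C.toFamily.arity D) => W i.castSucc)) (W (Fin.last _))
  rw [h₁, h₂]
  exact (dv_app_compl hc hD (fun i => X i.castSucc) (X (Fin.last _))).symm

section

variable {k : ℕ+} {X Y Z U : C.Str k}

theorem cons_castSucc_two {α : Type*} (a b : α) :
    (fun i : Fin 1 => ![a, b] i.castSucc) = fun _ => a := by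
  funext i; fin_cases i; rfl

theorem cons_castSucc_three {α : Type*} (a b c : α) :
    (fun i : Fin 2 => ![a, b, c] i.castSucc) = fun i => ![a, b] i := by
  funext i; fin_cases i <;> rfl

theorem dv_sOr : Dv 1 X (sOr Y Z) ↔ Dv 1 (sAnd Y.star Z.star) X.star := by
  have h := rel_or_iff (C := C) (T := C.Str) (st := Struct.star)
    (P := fun c hc x => Display C C.toFamily.Mem (mem_subset_full C.toFamily)
      (seqConn (C.clsBin k) c hc x)) (fun _ hc j x => display_dr1_iff hc j x)
    display_compl_iff Y Z X
  unfold seqConn at h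
  erw [cons_castSucc_three, cons_castSucc_three] at h
  exact h

theorem dv_shift : Dv 1 (sAnd X Y) Z ↔ Dv 1 X (sOr Z Y.star) :=
  ⟨.shift X Y Z, .shift_inv X Y Z⟩

/-- Contraposition in the first component, with the second kept as context. It comes from the shift
rule and the De Morgan reading of the comma on the right. -/
theorem dv_sAnd_star : Dv 1 (sAnd X Y) Z ↔ Dv 1 (sAnd Z.star Y) X.star := by
  rw [dv_shift, dv_sOr, Struct.star_star]

theorem dv_sImp : Dv 0 (.app (C.clsBin k) (skImp k) (C.imp_mem k) rfl
    (fun i : Fin 2 => ![X, Y] i)) Z ↔ Dv 1 (sAnd X Z) Y := by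
  have h := rel_imp_iff (C := C) (T := C.Str)
    (P := fun c hc x => Display C C.toFamily.Mem (mem_subset_full C.toFamily)
      (seqConn (C.clsBin k) c hc x)) (fun _ hc j x => display_dr1_iff hc j x) X Y Z
  unfold seqConn at h
  erw [cons_castSucc_three, cons_castSucc_three] at h
  exact h

theorem dv_exchange (h : Dv 1 (sAnd X Y) Z) : Dv 1 (sAnd Y X) Z := .ci X Y Z h

theorem dv_weak (h : Dv 1 X Z) : Dv 1 (sAnd X Y) Z := .weak X Y Z h

theorem dv_contract (h : Dv 1 (sAnd X X) Z) : Dv 1 X Z := .wi X Z h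

/-- `X ⊢ *Y` says that `X, Y` is contradictory. -/
theorem dv_star_right_iff : Dv 1 X Y.star ↔ ∀ Z, Dv 1 (sAnd X Y) Z := by
  constructor
  · intro h Z
    have h₁ : Dv 1 (sAnd Y Z.star) X.star := dv_weak (dv_star_comm'.1 h)
    have := dv_sAnd_star.1 (dv_exchange h₁)
    rw [Struct.star_star, Struct.star_star] at this
    exact this
  · intro h
    have := dv_sAnd_star.1 (h Y.star)
    rw [Struct.star_star] at this
    exact dv_star_comm'.1 (dv_contract this)

end

/-! ## The algebra of polar pairs of sets of structures -/

/-- A set of antecedents (sign `1`) and a set of consequents (sign `0`), each of which consists of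
all the structures that form a derivable sequent with every structure of the other. -/
structure Polar (C : BoolFamily.{u}) (k : ℕ+) where
  mem : Sgn → C.Str k → Prop
  mem_iff : ∀ s X, mem s X ↔ ∀ Y, mem (s + 1) Y → Dv s X Y

namespace Polar

variable {k : ℕ+} {a b : Polar C k}

theorem mem_of_eq {s t : Sgn} (h : t = s) {X : C.Str k} (hX : a.mem s X) : a.mem t X :=
  h ▸ hX

theorem dv {s : Sgn} {X Y : C.Str k} (hX : a.mem s X) (hY : a.mem (s + 1) Y) : Dv s X Y :=
  (a.mem_iff s X).1 hX Y hY

/-- The polar pair generated by a set of structures of sign `s`. -/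
def gen (s : Sgn) (G : C.Str k → Prop) : Polar C k where
  mem t X := if t = s then ∀ Z, (∀ Y, G Y → Dv s Y Z) → Dv s X Z else ∀ Y, G Y → Dv s Y X
  mem_iff t X := by
    by_cases h : t = s
    · subst h
      simp only [if_true, sgn_add_one_ne, if_false]
    · obtain rfl := sgn_ne h
      simp only [sgn_add_one_add_one, sgn_add_one_ne, if_true, if_false]
      constructor
      · intro hX Y hY
        exact dv_swap.2 (hY X hX)
      · intro hX Y hY
        exact dv_swap.1 (hX Y fun Z hZ => hZ Y hY)

theorem mem_gen_add_one {s : Sgn} {G : C.Str k → Prop} {X : C.Str k} :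
    (gen s G).mem (s + 1) X ↔ ∀ Y, G Y → Dv s Y X := by
  simp only [gen, sgn_add_one_ne, if_false]

theorem mem_gen_of {s : Sgn} {G : C.Str k → Prop} {X : C.Str k} (h : G X) : (gen s G).mem s X := by
  rw [mem_iff]
  exact fun Y hY => mem_gen_add_one.1 hY X h

/-- The two sets of a pair determine each other by orthogonality, so an inclusion on one side
reverses on the other. -/
theorem mem_mono (s : Sgn) (h : ∀ X, a.mem s X → b.mem s X) {X : C.Str k}
    (hX : b.mem (s + 1) X) : a.mem (s + 1) X := by
  rw [mem_iff, sgn_add_one_add_one]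
  exact fun Y hY => dv_swap.2 (b.dv (h Y hY) hX)

theorem le_of_signed (s : Sgn) (h : ∀ X, b.mem (s + 1) X → a.mem (s + 1) X) {X : C.Str k}
    (hX : a.mem s X) : b.mem s X := by
  have := mem_mono (a := b) (b := a) (s + 1) h (X := X)
  rw [sgn_add_one_add_one] at this
  exact this hX

/-- The operation of a connective on polar pairs. -/
def op (D : C.toFamily.Cls) (c : Skeleton (C.toFamily.arity D)) (hc : c ∈ C.toFamily.full D)
    (a : ∀ i : Fin (C.toFamily.arity D), Polar C (c.typ i.castSucc)) : Polar C c.out :=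
  gen c.quant fun Z => ∃ X, (∀ i, (a i).mem (c.quant + c.ton i.castSucc) (X i)) ∧
    Z = .app D c hc rfl X

section

variable {D : C.toFamily.Cls} {c : Skeleton (C.toFamily.arity D)} {hc : c ∈ C.toFamily.full D}
  {a b : ∀ i : Fin (C.toFamily.arity D), Polar C (c.typ i.castSucc)}

theorem mem_op_add_one {U : C.Str c.out} :
    (op D c hc a).mem (c.quant + 1) U ↔
      ∀ X, (∀ i, (a i).mem (c.quant + c.ton i.castSucc) (X i)) →
        Dv c.quant (.app D c hc rfl X) U := by
  rw [op, mem_gen_add_one]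
  exact ⟨fun h X hX => h _ ⟨X, hX, rfl⟩, by rintro h _ ⟨X, hX, rfl⟩; exact h X hX⟩

theorem mem_op_app {X : ∀ i : Fin (C.toFamily.arity D), C.Str (c.typ i.castSucc)}
    (hX : ∀ i, (a i).mem (c.quant + c.ton i.castSucc) (X i)) :
    (op D c hc a).mem c.quant (.app D c hc rfl X) :=
  mem_gen_of ⟨X, hX, rfl⟩

theorem op_mono (h : ∀ i X, (a i).mem (c.quant + c.ton i.castSucc) X →
    (b i).mem (c.quant + c.ton i.castSucc) X) {U : C.Str c.out}
    (hU : (op D c hc b).mem (c.quant + 1) U) : (op D c hc a).mem (c.quant + 1) U :=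
  mem_op_add_one.2 fun X hX => mem_op_add_one.1 hU X fun i => h i _ (hX i)

theorem op_le_op (h : ∀ i X, (a i).mem (1 + c.ton i.castSucc) X →
    (b i).mem (1 + c.ton i.castSucc) X) {U : C.Str c.out} (hU : (op D c hc a).mem 1 U) :
    (op D c hc b).mem 1 U := by
  rcases sgn_cases c.quant with hq | hq
  -- Here the generating structures are consequents, so the hypothesis is carried to the opposite
  -- sides, where it reverses.
  · have := op_mono (c := c) (hc := hc) (a := b) (b := a) (U := U)
    rw [hq] at this
    refine this (fun i X hX => ?_) hU
    have e : 0 + c.ton i.castSucc = 1 + c.ton i.castSucc + 1 := by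
      generalize c.ton i.castSucc = s
      revert s; decide
    rw [e] at hX ⊢
    exact mem_mono _ (h i) hX
  · refine le_of_signed 1 (fun Z hZ => ?_) hU
    have := op_mono (c := c) (hc := hc) (a := a) (b := b) (U := Z)
    rw [hq] at this
    exact this h hZ

end

theorem mem_weak {X : C.Str k} (Y : C.Str k) (h : a.mem 1 X) : a.mem 1 (sAnd X Y) := by
  rw [mem_iff] at h ⊢
  exact fun Z hZ => dv_weak (h Z hZ)

theorem mem_exchange {X Y : C.Str k} (h : a.mem 1 (sAnd X Y)) : a.mem 1 (sAnd Y X) := by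
  rw [mem_iff] at h ⊢
  exact fun Z hZ => dv_exchange (h Z hZ)

theorem mem_contract {X : C.Str k} (h : a.mem 1 (sAnd X X)) : a.mem 1 X := by
  rw [mem_iff] at h ⊢
  exact fun Z hZ => dv_contract (h Z hZ)

end Polar

/-! ### Interpretation of formulas by polar pairs, and soundness of the Hilbert calculus. -/

open Polar

/-- The interpretation of formulas by polar pairs. -/
def interp {C : BoolFamily.{u}} : ∀ {k : ℕ+}, C.FullFm k → Polar C k
  | _, .app D c hc hk φ => hk ▸ op D c hc fun i => interp (φ i)

section

variable {k : ℕ+} {φ ψ : C.FullFm k} {U X : C.Str k}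

/-- A consequent `U` of `¬φ` satisfies `[¬]Y ⊢ U` for all consequents `Y` of `φ`. The identification
of `[¬]` with `*` turns this into `*U ⊢ Y`. The other sign follows by orthogonality. -/
theorem mem_interp_fNot {s : Sgn} : (interp (fNot φ)).mem s U ↔ (interp φ).mem (s + 1) U.star := by
  have h₀ : ∀ U, (interp (fNot φ)).mem 0 U ↔ (interp φ).mem 1 U.star := by
    intro U
    refine (mem_op_add_one (C := C) (D := C.clsNot k) (c := skNot k)
      (hc := C.not_mem k) (a := fun _ => interp φ)).trans ?_
    rw [mem_iff]
    constructor
    · intro h Y hY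
      refine dv_star_comm.1 (.not_star _ _ (h (fun _ => Y) fun i => ?_))
      change Fin 1 at i
      fin_cases i
      exact mem_of_eq (side_skNot k) hY
    · intro h Y hY
      have e : Y = fun _ => Y (0 : Fin 1) := by
        funext i; change Fin 1 at i; fin_cases i; rfl
      rw [e]
      exact .star_not (Y (0 : Fin 1)) _
        (dv_star_comm.1 (h _ (mem_of_eq (side_skNot k).symm (hY (0 : Fin 1)))))
  rcases sgn_cases s with rfl | rfl
  · exact h₀ U
  · rw [mem_iff, mem_iff]
    constructor
    · intro h Y hY
      refine dv_swap.1 (dv_star_comm'.1 (h Y.star ((h₀ _).2 ?_)))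
      rw [Struct.star_star]; exact hY
    · intro h Y hY
      have := h Y.star ((h₀ _).1 hY)
      exact dv_star.1 this

/-- Weakening and exchange give one inclusion, contraction the other: conjunction is intersection of
the sets of antecedents. -/
theorem mem_interp_fAnd :
    (interp (fAnd φ ψ)).mem 1 U ↔ (interp φ).mem 1 U ∧ (interp ψ).mem 1 U := by
  have h₀ : ∀ Z, (interp (fAnd φ ψ)).mem 0 Z ↔
      ∀ X Y, (interp φ).mem 1 X → (interp ψ).mem 1 Y → Dv 1 (sAnd X Y) Z := by
    intro Z
    refine (mem_op_add_one (C := C) (D := C.clsBin k) (c := skAnd k)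
      (hc := C.and_mem k) (a := fun i : Fin 2 => interp (![φ, ψ] i))).trans ?_
    constructor
    · intro h X Y hX hY
      refine h (fun i : Fin 2 => ![X, Y] i) fun i => ?_
      change Fin 2 at i
      fin_cases i
      · exact hX
      · exact hY
    · intro h X hX
      have e : X = fun i : Fin 2 => (![X (0 : Fin 2), X (1 : Fin 2)] : Fin 2 → C.Str k) i := by
        funext i; change Fin 2 at i; fin_cases i <;> rfl
      rw [e]
      exact h _ _ (hX (0 : Fin 2)) (hX (1 : Fin 2))
  constructor
  · intro h
    constructor
    · rw [mem_iff] at h ⊢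
      refine fun Z hZ => h Z ((h₀ Z).2 fun X Y hX _ => dv_weak ((interp φ).dv hX hZ))
    · rw [mem_iff] at h ⊢
      refine fun Z hZ => h Z ((h₀ Z).2 fun X Y _ hY =>
        dv_exchange (dv_weak ((interp ψ).dv hY hZ)))
  · rintro ⟨h₁, h₂⟩
    rw [mem_iff]
    exact fun Z hZ => dv_contract ((h₀ Z).1 hZ U U h₁ h₂)

theorem mem_interp_fImp :
    (interp (fImp φ ψ)).mem 1 U ↔
      ∀ X, (interp φ).mem 1 X → (interp ψ).mem 1 (sAnd X U) := by
  refine (mem_op_add_one (C := C) (D := C.clsBin k) (c := skImp k)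
      (hc := C.imp_mem k) (a := fun i : Fin 2 => interp (![φ, ψ] i))).trans ?_
  constructor
  · intro h X hX
    rw [mem_iff]
    intro Y hY
    refine dv_sImp.1 (h (fun i : Fin 2 => ![X, Y] i) fun i => ?_)
    change Fin 2 at i
    fin_cases i
    · exact mem_of_eq (side_skImp_zero k) hX
    · exact mem_of_eq (side_skImp_one k) hY
  · intro h X hX
    have e : X = fun i : Fin 2 => (![X (0 : Fin 2), X (1 : Fin 2)] : Fin 2 → C.Str k) i := by
      funext i; change Fin 2 at i; fin_cases i <;> rfl
    rw [e]
    exact dv_sImp.2 ((interp ψ).dv (h _ (mem_of_eq (side_skImp_zero k).symm (hX (0 : Fin 2))))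
      (mem_of_eq (side_skImp_one k).symm (hX (1 : Fin 2))))

/-- Contraction removes the duplicated antecedent in one direction and weakening adds the arbitrary
one in the other. Thus provable implication becomes inclusion. -/
theorem valid_fImp :
    (∀ U, (interp (fImp φ ψ)).mem 1 U) ↔ ∀ X, (interp φ).mem 1 X → (interp ψ).mem 1 X := by
  simp only [mem_interp_fImp]
  exact ⟨fun h X hX => mem_contract (h X X hX), fun h U X hX => mem_weak U (h X hX)⟩

theorem mem_interp_fTop : (interp (fTop : C.FullFm k)).mem 1 U := by
  rw [mem_iff]
  intro Z hZ
  have h : Dv 1 (sI : C.Str k) Z :=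
    (mem_op_add_one (C := C) (D := C.clsConst k) (c := skTop k)
      (hc := C.top_mem k) (a := fun i => interp (Fin.elim0 i : C.FullFm k))).1 hZ
      (fun i => Fin.elim0 i) fun i => Fin.elim0 i
  exact .iwi _ _ (dv_exchange (dv_weak h))

theorem Struct.app_congr {F : Family.{u}} {M : F.Sub} {D : F.Cls} {c c' : Skeleton (F.arity D)}
    (h : c = c') {hc : c ∈ F.full D} {hc' : c' ∈ F.full D} {hk : c.out = k} {hk' : c'.out = k}
    {X : ∀ i : Fin (F.arity D), Struct F M (c.typ i.castSucc)}
    {X' : ∀ i : Fin (F.arity D), Struct F M (c'.typ i.castSucc)} (hX : ∀ i, HEq (X i) (X' i)) :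
    Struct.app D c hc hk X = Struct.app D c' hc' hk' X' := by
  subst h
  rw [funext fun i => eq_of_heq (hX i)]

theorem star_bot : (Struct.app (C.clsConst k) (skBot k) (C.bot_mem k) rfl fun i => Fin.elim0 i :
    C.Str k).star = sI :=
  Struct.app_congr (F := C.toFamily) (compl_skBot k) fun i => Fin.elim0 i

/-- Dual to the case of `⊤`: since `*[⊥]` is `[⊤]`, dr2 reduces the claim to weakening and
elimination of `I`. -/
theorem not_mem_interp_fBot : (interp (fBot : C.FullFm k)).mem 0 U := by
  rw [mem_iff]
  intro Y hY
  have h : Dv 0 (Struct.app (C.clsConst k) (skBot k) (C.bot_mem k) rfl fun i => Fin.elim0 i) Y :=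
    (mem_op_add_one (C := C) (D := C.clsConst k) (c := skBot k)
      (hc := C.bot_mem k) (a := fun i => interp (Fin.elim0 i : C.FullFm k))).1 hY
      (fun i => Fin.elim0 i) fun i => Fin.elim0 i
  have h' : Dv 1 (sI : C.Str k) Y.star := star_bot ▸ (dv_star (k := k)).2 h
  refine dv_star.1 (?_ : Dv 1 U.star Y.star)
  exact .iwi _ _ (dv_exchange (dv_weak h'))

theorem mem_interp_app_of_heq {s : Sgn} {D : C.toFamily.Cls} {c : Skeleton (C.toFamily.arity D)}
    {hc : c ∈ C.toFamily.full D} {hk : c.out = k}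
    {φ : ∀ i : Fin (C.toFamily.arity D), C.FullFm (c.typ i.castSucc)} {X : C.Str k}
    {Y : C.Str c.out} (hXY : HEq X Y) (hX : (interp (.app D c hc hk φ)).mem s X) :
    (op D c hc fun i => interp (φ i)).mem s Y := by
  subst hk
  rw [← eq_of_heq hXY]
  exact hX

end

/-- The common content of A7 and A8. After dr1 the sequent has the residual of the other entries on
one side and `Xⱼ` on the other. These lie in opposite sets of the pair interpreting the residual. -/
theorem mem_interp_resid {D : C.toFamily.Cls} {c : Skeleton (C.toFamily.arity D)}
    (hc : c ∈ C.toFamily.full D) (j : Fin (C.toFamily.arity D))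
    (φ : ∀ i : Fin (C.toFamily.arity D + 1), C.FullFm (c.typ i)) {Z : C.Str c.out}
    (hZ : (interp (φ (Fin.last _))).mem (c.quant + 1) Z) :
    (interp (.app D c hc rfl (Function.update (fun i => φ i.castSucc) j
      (.app D (c.resid j) (Family.resid_mem_full hc j) (c.resid_out j)
        fun i => φ (Equiv.swap j.castSucc (Fin.last _) i.castSucc))))).mem (c.quant + 1) Z := by
  refine mem_op_add_one.2 fun X hX => ?_
  let T : ∀ i : Fin (C.toFamily.arity D + 1), C.Str (c.typ i) :=
    -- `Z` fills the output place, so that dr1 can exchange it with the entry at `j`.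
    Fin.lastCases (motive := fun i => C.Str (c.typ i)) Z X
  have hT₁ : (fun i : Fin _ => T i.castSucc) = X := funext fun i => Fin.lastCases_castSucc _
  have hT₂ : T (Fin.last _) = Z := Fin.lastCases_last
  have hT : ∀ i, i ≠ j.castSucc → (interp (φ i)).mem (c.side i) (T i) := by
    intro i hi
    induction i using Fin.lastCases with
    | last => rw [side_last, hT₂]; exact hZ
    | cast i =>
      have hij : i ≠ j := fun e => hi (e ▸ rfl)
      have := hX i
      rw [Function.update_of_ne hij] at this
      rw [side_castSucc, congrFun hT₁ i]
      exact this
  have h : Display C C.toFamily.Mem (mem_subset_full C.toFamily) (seqConn D c hc T) := by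
    rw [display_dr1_iff hc j]
    refine Polar.dv (a := op D (c.resid j) (Family.resid_mem_full hc j) fun i =>
      interp (φ (Equiv.swap j.castSucc (Fin.last _) i.castSucc))) (mem_op_app fun i => ?_) ?_
    · rw [← side_castSucc, side_resid]
      refine hT _ ?_
      rw [Ne, Equiv.swap_apply_eq_iff, Equiv.swap_apply_left]
      exact (Fin.castSucc_lt_last i).ne
    · have := hX j
      rw [Function.update_self, ← side_castSucc] at this
      rw [quant_resid, sgn_add_one_add_one]
      refine mem_interp_app_of_heq ?_ this
      rw [← hT₁]
      exact congr_arg_heq T (Equiv.swap_apply_right _ _).symm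
  unfold seqConn at h
  rw [hT₁, hT₂] at h
  exact h

/-- On the side `Æ(⋆)`, membership is tested against the structures generating `⋆` and `-⋆`, and dr2
matches the two tests. The other side follows by orthogonality. -/
theorem interp_compl {D : C.toFamily.Cls} {c : Skeleton (C.toFamily.arity D)}
    (hc : c ∈ C.toFamily.full D) (hD : C.toFamily.isVar D = false)
    (φ : ∀ i : Fin (C.toFamily.arity D), C.FullFm (c.typ i.castSucc)) {s : Sgn} {U : C.Str c.out} :
    (interp (fNot (.app D c hc rfl φ))).mem s U ↔
      (interp (.app D c.compl (Family.compl_mem_full hc hD) rfl φ)).mem s U := by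
  have h : ∀ U, (interp (fNot (.app D c hc rfl φ))).mem c.quant U ↔
      (interp (.app D c.compl (Family.compl_mem_full hc hD) rfl φ : C.FullFm c.out)).mem
        c.quant U := by
    intro U
    rw [mem_interp_fNot]
    refine mem_op_add_one.trans ?_
    have := mem_op_add_one (C := C) (c := c.compl) (hc := Family.compl_mem_full hc hD)
      (a := fun i => interp (φ i)) (U := U)
    rw [quant_compl, sgn_add_one_add_one] at this
    refine Iff.trans ?_ this.symm
    have e : ∀ i : Fin (C.toFamily.arity D), c.quant + 1 + c.compl.ton i.castSucc =
        c.quant + c.ton i.castSucc := by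
      intro i
      rw [← side_castSucc, ← side_compl, side_castSucc, quant_compl]
    simp only [e]
    refine forall_congr' fun X => imp_congr_right fun _ => ?_
    rw [← dv_star, Struct.star_star]
    rw [Struct.star_app hD]
    rfl
  by_cases hs : s = c.quant
  · subst hs; exact h U
  · obtain rfl := sgn_ne hs
    exact ⟨mem_mono _ fun X => (h X).2, mem_mono _ fun X => (h X).1⟩

theorem AHL.valid {k : ℕ+} {φ : C.FullFm k} (h : AHL C φ) (U : C.Str k) : (interp φ).mem 1 U := by
  induction h with
  | a0 => exact mem_interp_fTop
  | a0' => exact mem_interp_fNot.2 not_mem_interp_fBot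
  | a1 φ => exact valid_fImp.2 (fun X hX => mem_interp_fAnd.2 ⟨hX, hX⟩) U
  | a2 φ ψ => exact valid_fImp.2 (fun X hX => (mem_interp_fAnd.1 hX).1) U
  | a3 φ ψ ρ =>
    refine valid_fImp.2 (fun P hP => mem_interp_fImp.2 fun Q hQ => mem_interp_fNot.2 ?_) U
    change (interp (fAnd ρ φ)).mem 0 _
    rw [mem_iff]
    intro V hV
    -- The calculus has no rule of associativity. Instead every hypothesis is weakened to the one
    -- structure `V, (Q, P)`, and copies of it are contracted. This structure is an antecedent of `ψ
    -- ∧ ρ` and its star a consequent, so it is contradictory.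
    refine dv_star_right_iff.2 fun Z => ?_
    obtain ⟨hρ, hφ⟩ := mem_interp_fAnd.1 (mem_weak (sAnd Q P) hV)
    have hQ' := mem_exchange (mem_weak V (mem_weak P hQ))
    have hP' := mem_exchange (mem_weak V (mem_exchange (mem_weak Q hP)))
    have hψ := mem_contract (mem_interp_fImp.1 hP' _ hφ)
    exact dv_contract (dv_star_right_iff.1 (dv_swap.1 ((interp (fAnd ψ ρ)).dv
      (mem_interp_fNot.1 hQ') (mem_interp_fAnd.2 ⟨hψ, hρ⟩))) Z)
  | a4 hc hD φ =>
    exact mem_interp_fAnd.2 ⟨valid_fImp.2 (fun X => (interp_compl hc hD φ).1) U,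
      valid_fImp.2 (fun X => (interp_compl hc hD φ).2) U⟩
  | a7 hc j φ hq =>
    refine valid_fImp.2 (fun X hX => le_of_signed 1 (fun Z hZ => ?_) hX) U
    have := mem_interp_resid hc j φ (Z := Z)
    rw [hq] at this
    exact this hZ
  | a8 hc j φ hq =>
    refine valid_fImp.2 (fun X hX => ?_) U
    have := mem_interp_resid hc j φ (Z := X)
    rw [hq] at this
    exact this hX
  | r3 hc j φ ψ hj _ ih =>
    refine valid_fImp.2 (fun X hX => ?_) U
    refine op_le_op (hc := hc) (a := fun i => interp (φ i))
      (b := fun i => interp (Function.update φ j ψ i)) (fun i Y hY => ?_) hX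
    by_cases hi : i = j
    · subst hi
      rw [hj] at hY ⊢
      rw [Function.update_self]
      exact valid_fImp.1 ih Y hY
    · rwa [Function.update_of_ne hi]
  | r4 hc j φ ψ hj _ ih =>
    refine valid_fImp.2 (fun X hX => ?_) U
    refine op_le_op (hc := hc) (a := fun i => interp (φ i))
      (b := fun i => interp (Function.update φ j ψ i)) (fun i Y hY => ?_) hX
    by_cases hi : i = j
    · subst hi
      rw [hj] at hY ⊢
      rw [Function.update_self]
      exact mem_mono 1 (valid_fImp.1 ih) hY
    · rwa [Function.update_of_ne hi]
  | mp φ ψ _ _ ih₁ ih₂ => exact valid_fImp.1 ih₂ U (ih₁ U)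

/-! ## From the Hilbert calculus to the display calculus -/

/-- On the side `Æ(⋆)` this is the rule `⋆ ⊢`, on the other side the rule `⊢ ⋆`, the arguments being
handled by induction. -/
theorem mem_interp_incl : ∀ {k : ℕ+} (φ : C.Fm k) (s : Sgn), (interp φ.incl).mem s (.form φ)
  | _, .app D c hc hk φ, s => by
    subst hk
    by_cases hs : s = c.quant
    · subst hs
      rw [mem_iff]
      intro U hU
      exact .conn_left hc φ U (mem_op_add_one.1 hU _ fun i => mem_interp_incl (φ i) _)
    · obtain rfl := sgn_ne hs
      refine mem_op_add_one.2 fun X hX => .conn_right hc X φ fun i => ?_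
      exact (interp (φ i).incl).dv (hX i) (mem_interp_incl (φ i) _)

/-- A structure `[⋆](X₁, …, Xₙ)` is one of the generators on the side `Æ(⋆)` only, hence the
condition on signs. -/
theorem mem_interp_tau : ∀ {k : ℕ+} (X : C.Str k) (s : Sgn), X.Signed s → (interp (tau X)).mem s X
  | _, .form φ, s, _ => mem_interp_incl φ s
  | _, .starForm φ, s, _ => mem_interp_fNot.2 (mem_interp_incl φ _)
  | _, .app D c hc hk X, s, h => by
    subst hk
    obtain ⟨rfl, h⟩ := h
    exact mem_op_app fun i => mem_interp_tau (X i) _ (h i)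
  | _, .starApp D hD c hc hk X, s, h => by
    subst hk
    obtain ⟨rfl, h⟩ := h
    refine mem_interp_fNot.2 ?_
    rw [sgn_add_one_add_one]
    exact mem_op_app fun i => mem_interp_tau (X i) _ (h i)

theorem AHL.ggl {k : ℕ+} {X Y : C.Str k} (hX : X.Signed 1) (hY : Y.Signed 0)
    (h : AHL C (fImp (tau X) (tau Y))) : GGL C X Y :=
  (interp (tau Y)).dv (valid_fImp.1 h.valid X (mem_interp_tau X 1 hX)) (mem_interp_tau Y 0 hY)

/-! ## The order of the Hilbert calculus -/

/-- Provable implication. -/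
def Le {k : ℕ+} (φ ψ : C.FullFm k) : Prop := AHL C (fImp φ ψ)

section

variable {k : ℕ+} {φ φ' ψ ψ' χ ρ t : C.FullFm k}

theorem Le.mp (h : Le φ ψ) (hφ : AHL C φ) : AHL C ψ := .mp φ ψ hφ h

theorem update_fin_two_one {α : Type*} (a b c : α) :
    Function.update (fun i : Fin 2 => ![a, b] i) 1 c = fun i => ![a, c] i := by
  funext i; fin_cases i <;> rfl

/-- Implication is itself a connective of tonicity `+` in its second place, so R3 yields
transitivity of provable implication. -/
theorem le_fImp_right (h : Le ψ χ) : Le (fImp φ ψ) (fImp φ χ) := by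
  have h₁ := AHL.r3 (C := C) (D := C.clsBin k) (c := skImp k) (C.imp_mem k) (1 : Fin 2)
    (fun i : Fin 2 => (![φ, ψ] : Fin 2 → C.FullFm k) i) χ rfl h
  erw [update_fin_two_one] at h₁
  exact h₁

theorem Le.trans (h₁ : Le φ ψ) (h₂ : Le ψ χ) : Le φ χ := (le_fImp_right h₂).mp h₁

theorem le_refl (φ : C.FullFm k) : Le φ φ := Le.trans (.a1 φ) (.a2 φ φ)

theorem fAnd_le_left : Le (fAnd φ ψ) φ := .a2 φ ψ

/-- `φ` implies `ψ` for the sign `1`, and conversely for the sign `0`. -/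
def LeS (s : Sgn) (φ ψ : C.FullFm k) : Prop := if s = 1 then Le φ ψ else Le ψ φ

theorem leS_swap {s : Sgn} : LeS (s + 1) ψ φ ↔ LeS s φ ψ := by
  rcases sgn_cases s with rfl | rfl
  · exact Iff.rfl
  · exact Iff.rfl

theorem leS_refl (s : Sgn) (φ : C.FullFm k) : LeS s φ φ := by
  rcases sgn_cases s with rfl | rfl
  · exact le_refl φ
  · exact le_refl φ

theorem LeS.trans {s : Sgn} (h₁ : LeS s φ ψ) (h₂ : LeS s ψ χ) : LeS s φ χ := by
  rcases sgn_cases s with rfl | rfl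
  · exact Le.trans (show Le χ ψ from h₂) h₁
  · exact Le.trans (show Le φ ψ from h₁) h₂

end

section

variable {D : C.toFamily.Cls} {c : Skeleton (C.toFamily.arity D)}

theorem le_app_update (hc : c ∈ C.toFamily.full D) (j : Fin (C.toFamily.arity D))
    (φ : ∀ i : Fin (C.toFamily.arity D), C.FullFm (c.typ i.castSucc))
    (ψ : C.FullFm (c.typ j.castSucc)) (h : LeS (1 + c.ton j.castSucc) (φ j) ψ) :
    Le (.app D c hc rfl φ : C.FullFm c.out) (.app D c hc rfl (Function.update φ j ψ)) := by
  rcases sgn_cases (c.ton j.castSucc) with hj | hj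
  · rw [hj] at h; exact .r3 hc j φ ψ hj h
  · rw [hj] at h; exact .r4 hc j φ ψ hj h

theorem le_app (hc : c ∈ C.toFamily.full D)
    (φ ψ : ∀ i : Fin (C.toFamily.arity D), C.FullFm (c.typ i.castSucc))
    (h : ∀ i, LeS (1 + c.ton i.castSucc) (φ i) (ψ i)) :
    Le (.app D c hc rfl φ : C.FullFm c.out) (.app D c hc rfl ψ) := by
  -- R3 and R4 change one argument at a time, so the set of changed arguments grows by induction.
  have key : ∀ s : Finset (Fin (C.toFamily.arity D)),
      Le (.app D c hc rfl φ : C.FullFm c.out) (.app D c hc rfl (s.piecewise ψ φ)) := by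
    intro s
    induction s using Finset.induction with
    | empty => rw [Finset.piecewise_empty]; exact le_refl _
    | insert j s hj ih =>
      rw [Finset.piecewise_insert]
      refine ih.trans (le_app_update hc j _ _ ?_)
      rw [Finset.piecewise_eq_of_notMem _ _ _ hj]
      exact h j
  have := key Finset.univ
  rwa [Finset.piecewise_univ] at this

theorem leS_app (hc : c ∈ C.toFamily.full D) (s : Sgn)
    (φ ψ : ∀ i : Fin (C.toFamily.arity D), C.FullFm (c.typ i.castSucc))
    (h : ∀ i, LeS (s + c.ton i.castSucc) (φ i) (ψ i)) :
    LeS s (.app D c hc rfl φ : C.FullFm c.out) (.app D c hc rfl ψ) := by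
  rcases sgn_cases s with rfl | rfl
  · refine le_app hc ψ φ fun i => ?_
    rw [← leS_swap]
    convert h i using 1
    generalize c.ton i.castSucc = s
    revert s; decide
  · exact le_app hc φ ψ h

theorem app_heq {F : Family.{u}} {M : F.Sub} {D : F.Cls} {c c' : Skeleton (F.arity D)}
    {k k' : ℕ+} (h : c = c') (hk : k = k') {hc : c ∈ M D} {hc' : c' ∈ M D} {e : c.out = k}
    {e' : c'.out = k'} {φ : ∀ i : Fin (F.arity D), Formula F M (c.typ i.castSucc)}
    {φ' : ∀ i : Fin (F.arity D), Formula F M (c'.typ i.castSucc)} (hφ : ∀ i, HEq (φ i) (φ' i)) :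
    HEq (Formula.app D c hc e φ) (Formula.app D c' hc' e' φ') := by
  subst h hk
  rw [funext fun i => eq_of_heq (hφ i)]

theorem leS_heq {k k' : ℕ+} (hk : k = k') {φ ψ : C.FullFm k} {φ' ψ' : C.FullFm k'} {s : Sgn}
    (h₁ : HEq φ φ') (h₂ : HEq ψ ψ') (h : LeS s φ ψ) : LeS s φ' ψ' := by
  subst hk
  rwa [← eq_of_heq h₁, ← eq_of_heq h₂]

/-- The order relation `S_Æ(⋆(φ₁, …, φₙ), φₙ₊₁)`. -/
def leConn (D : C.toFamily.Cls) (c : Skeleton (C.toFamily.arity D)) (hc : c ∈ C.toFamily.full D)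
    (φ : ∀ i : Fin (C.toFamily.arity D + 1), C.FullFm (c.typ i)) : Prop :=
  LeS c.quant (.app D c hc rfl fun i => φ i.castSucc) (φ (Fin.last _))

theorem leS_adjoint (hc : c ∈ C.toFamily.full D) (j : Fin (C.toFamily.arity D))
    (φ : ∀ i : Fin (C.toFamily.arity D + 1), C.FullFm (c.typ i)) :
    LeS c.quant (.app D c hc rfl (Function.update (fun i => φ i.castSucc) j
          (.app D (c.resid j) (Family.resid_mem_full hc j) (c.resid_out j)
            fun i => φ (Equiv.swap j.castSucc (Fin.last _) i.castSucc)))) (φ (Fin.last _)) := by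
  rcases sgn_cases c.quant with hq | hq
  · have := AHL.a8 hc j φ hq
    rw [hq]; exact this
  · have := AHL.a7 hc j φ hq
    rw [hq]; exact this

theorem leConn_of_entry (hc : c ∈ C.toFamily.full D) (j : Fin (C.toFamily.arity D))
    (φ : ∀ i : Fin (C.toFamily.arity D + 1), C.FullFm (c.typ i))
    (h : LeS (c.side j.castSucc) (φ j.castSucc)
      (.app D (c.resid j) (Family.resid_mem_full hc j) (c.resid_out j)
        fun i => φ (Equiv.swap j.castSucc (Fin.last _) i.castSucc))) : leConn D c hc φ := by
  refine LeS.trans (leS_app _ _ _ _ fun i => ?_) (leS_adjoint hc j φ)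
  by_cases hi : i = j
  · subst hi
    rw [Function.update_self, ← side_castSucc]
    exact h
  · rw [Function.update_of_ne hi]
    exact leS_refl _ _

/-- The residual of the residual is the original connective, so the hypothesis is exactly the
comparison of entry `j` required by `leConn_of_entry`. -/
theorem leConn_resid (hc : c ∈ C.toFamily.full D) (j : Fin (C.toFamily.arity D))
    (φ : ∀ i : Fin (C.toFamily.arity D + 1), C.FullFm (c.typ i)) (h : leConn D c hc φ) :
    leConn D (c.resid j) (Family.resid_mem_full hc j)
      fun i => φ (Equiv.swap j.castSucc (Fin.last _) i) := by
  refine leConn_of_entry _ j _ ?_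
  have hs : (c.resid j).side j.castSucc = c.quant + 1 := by
    rw [side_resid, Equiv.swap_apply_left, side_last]
  rw [hs]
  refine leS_swap.2 ?_
  have e := Equiv.swap_apply_left j.castSucc (Fin.last (C.toFamily.arity D))
  refine leS_heq (congrArg c.typ e).symm ?_ (congr_arg_heq φ e).symm h
  refine app_heq (c.resid_resid j).symm (congrArg c.typ e).symm fun m => ?_
  exact (congr_arg_heq φ (Equiv.swap_apply_self _ _ _)).symm

theorem leConn_resid_iff (c : Skeleton (C.toFamily.arity D)) (hc : c ∈ C.toFamily.full D)
    (j : Fin (C.toFamily.arity D))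
    (φ : ∀ i : Fin (C.toFamily.arity D + 1), C.FullFm (c.typ i)) :
    leConn D c hc φ ↔ leConn D (c.resid j) (Family.resid_mem_full hc j)
      fun i => φ (Equiv.swap j.castSucc (Fin.last _) i) := by
  refine ⟨leConn_resid hc j φ, fun h => ?_⟩
  refine (rel_congr (T := C.FullFm) (P := leConn D) (c.resid_resid j) fun i => ?_).1
    (leConn_resid _ j _ h)
  exact congr_arg_heq φ (Equiv.swap_apply_self _ _ i)

end

/-! ## Boolean reasoning in the Hilbert calculus -/

section

variable {k : ℕ+} {φ φ' ψ ψ' χ ρ t : C.FullFm k}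

/-- `→` is the residual of `∧` in its second place; no Boolean axiom is needed. -/
theorem le_fImp_iff : Le χ (fImp φ ψ) ↔ Le (fAnd φ χ) ψ := by
  have h := rel_imp_iff (C := C) (T := C.FullFm) (P := leConn (C.clsBin k))
    (fun c hc j x => leConn_resid_iff c hc j x) φ ψ χ
  unfold leConn at h
  erw [cons_castSucc_three, cons_castSucc_three] at h
  exact h

theorem fAnd_le_fAnd (h₁ : Le φ φ') (h₂ : Le ψ ψ') : Le (fAnd φ ψ) (fAnd φ' ψ') := by
  refine le_app (C := C) (D := C.clsBin k) (c := skAnd k) (C.and_mem k)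
    (fun i : Fin 2 => (![φ, ψ] : Fin 2 → C.FullFm k) i)
    (fun i : Fin 2 => (![φ', ψ'] : Fin 2 → C.FullFm k) i) fun i => ?_
  change Fin 2 at i
  fin_cases i
  · exact h₁
  · exact h₂

theorem fImp_le_fImp (h₁ : Le φ' φ) (h₂ : Le ψ ψ') : Le (fImp φ ψ) (fImp φ' ψ') :=
  le_fImp_iff.2 ((fAnd_le_fAnd h₁ (le_refl _)).trans (le_fImp_iff.1 (le_fImp_right h₂)))

theorem fNot_le_fNot (h : Le φ ψ) : Le (fNot ψ) (fNot φ) := by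
  refine le_app (C := C) (D := C.clsNot k) (c := skNot k) (C.not_mem k)
    (fun _ => ψ) (fun _ => φ) fun i => ?_
  change Fin 1 at i
  fin_cases i
  exact h

theorem fAnd_fImp_le : Le (fAnd φ (fImp φ ψ)) ψ := le_fImp_iff.1 (le_refl _)

theorem le_fImp_fAnd : Le ψ (fImp φ (fAnd φ ψ)) := le_fImp_iff.2 (le_refl _)

theorem le_fAnd_of_valid (ht : AHL C t) : Le φ (fAnd φ t) := le_fImp_fAnd.mp ht

theorem fNot_fAnd_comm : Le (fNot (fAnd φ ψ)) (fNot (fAnd ψ φ)) :=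
  Le.mp (AHL.a3 φ φ ψ) (le_refl φ)

theorem le_fImp_self : Le χ (fImp φ φ) := le_fImp_iff.2 fAnd_le_left

/-- A tautology that every formula implies. -/
def fOne : C.FullFm k := fImp fTop fTop

/-- A contradiction that implies every formula. -/
def fZero : C.FullFm k := fNot fOne

theorem valid_fOne : AHL C (fOne : C.FullFm k) := le_refl fTop

theorem le_fOne : Le φ fOne := le_fImp_self

/-- Residuating `¬` turns the claim into an implication with conclusion `fOne`. -/
theorem fZero_le : Le fZero φ := by
  have h := leConn_resid_iff (C := C) (D := C.clsNot k) (skNot k) (C.not_mem k) (0 : Fin 1)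
    (fun i : Fin 2 => (![fOne, φ] : Fin 2 → C.FullFm k) i)
  unfold leConn at h
  erw [cons_castSucc_two] at h
  exact h.2 le_fOne

theorem valid_fNot_fZero : AHL C (fNot fZero : C.FullFm k) := Le.mp (fNot_le_fNot fZero_le) .a0'

/-- A3 is applied to `φ → (φ ∧ ψ)`, which `ψ` implies. Its third formula is the valid `fOne`, which
is then absorbed. -/
theorem fNot_fAnd_fAnd_le : Le (fAnd (fNot (fAnd φ ψ)) ψ) (fNot φ) := by
  have h₁ : Le ψ (fImp (fNot (fAnd (fAnd φ ψ) fOne)) (fNot (fAnd fOne φ))) :=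
    le_fImp_fAnd.trans (.a3 _ _ _)
  exact ((fAnd_le_fAnd (fNot_le_fNot fAnd_le_left) (le_refl ψ)).trans (le_fImp_iff.1 h₁)).trans
    (fNot_fAnd_comm.trans (fNot_le_fNot (le_fAnd_of_valid valid_fOne)))

theorem fNot_le_fZero_of_valid_fAnd (h : AHL C (fAnd φ ψ)) : Le (fNot ψ) fZero := by
  have h₁ : AHL C (fAnd fOne ψ) := Le.mp (fAnd_le_fAnd le_fOne (le_refl ψ)) h
  have h₂ : Le (fNot (fAnd fOne ψ)) fZero :=
    (fNot_le_fNot fAnd_le_left).trans (fNot_fAnd_comm.trans (fNot_le_fNot (le_fAnd_of_valid h₁)))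
  exact (fNot_le_fNot fAnd_le_left).trans (fNot_fAnd_comm.trans h₂)

/-- With `m = -∧(ψ, ψ)`, only left conjuncts of A4 are used to get `¬m ≤ ψ ∧ ψ`, so it suffices to
prove `¬m`. The right conjunct of A4 is `m → ¬(ψ ∧ ψ)`, hence implies `m → 0`. Although it cannot be
detached, `fNot_le_fZero_of_valid_fAnd` shows that the negation of `m → 0` implies `0`.
Contraposition with `m` as context then gives `¬m`. -/
theorem valid_of_valid_fAnd (h : AHL C (fAnd φ ψ)) : AHL C ψ := by
  let m : C.FullFm k := .app (C.clsBin k) (skAnd k).compl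
    (Family.compl_mem_full (C.and_mem k) rfl) rfl fun i : Fin 2 => ![ψ, ψ] i
  have h₁ : AHL C (fIff (fNot (fAnd ψ ψ)) m) :=
    .a4 (C := C) (D := C.clsBin k) (C.and_mem k) rfl fun i : Fin 2 => ![ψ, ψ] i
  have h₂ : Le (fNot m) (fAnd ψ ψ) := by
    have := Le.mp fAnd_le_left (.a4 (C := C) (D := C.clsBin k)
      (Family.compl_mem_full (C.and_mem k) rfl) rfl fun i : Fin 2 => ![ψ, ψ] i)
    have e : Formula.app (k := k) (C.clsBin k) (skAnd k).compl.compl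
        (Family.compl_mem_full (Family.compl_mem_full (C.and_mem k) rfl) rfl) rfl
        (fun i : Fin 2 => (![ψ, ψ] : Fin 2 → C.FullFm k) i) = fAnd ψ ψ :=
      eq_of_heq (app_heq (F := C.toFamily) (D := C.clsBin k) (skAnd k).compl_compl rfl
        fun i => HEq.rfl)
    exact e ▸ this
  have h₃ : Le (fImp m (fNot (fAnd ψ ψ))) (fImp m fZero) :=
    fImp_le_fImp (le_refl _) ((fNot_le_fNot (.a1 ψ)).trans (fNot_le_fZero_of_valid_fAnd h))
  have h₄ : Le (fNot (fImp m fZero)) fZero :=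
    fNot_le_fZero_of_valid_fAnd (Le.mp (fAnd_le_fAnd (le_refl _) h₃) h₁)
  have h₅ : Le (fNot fZero) (fNot (fAnd (fImp m fZero) m)) :=
    (fNot_le_fNot fAnd_fImp_le).trans fNot_fAnd_comm
  have h₆ : Le (fAnd (fNot fZero) m) fZero :=
    (fAnd_le_fAnd h₅ (le_refl m)).trans (fNot_fAnd_fAnd_le.trans h₄)
  -- Contraposing the previous inequality and dropping the valid conjunct `¬0` leaves `¬m`.
  have h₇ : Le (fNot fZero) (fNot m) :=
    (fNot_le_fNot h₆).trans (fNot_fAnd_comm.trans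
      (fNot_le_fNot (le_fAnd_of_valid valid_fNot_fZero)))
  exact Le.mp (h₂.trans fAnd_le_left) (h₇.mp valid_fNot_fZero)

end

/-! ### Both halves of A4, double negation and De Morgan laws. -/

section

variable {D : C.toFamily.Cls} {c : Skeleton (C.toFamily.arity D)}

theorem fNot_app_le (hc : c ∈ C.toFamily.full D) (hD : C.toFamily.isVar D = false)
    (φ : ∀ i : Fin (C.toFamily.arity D), C.FullFm (c.typ i.castSucc)) :
    Le (fNot (.app D c hc rfl φ : C.FullFm c.out))
      (.app D c.compl (Family.compl_mem_full hc hD) rfl φ) :=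
  Le.mp fAnd_le_left (.a4 hc hD φ)

theorem le_fNot_app (hc : c ∈ C.toFamily.full D) (hD : C.toFamily.isVar D = false)
    (φ : ∀ i : Fin (C.toFamily.arity D), C.FullFm (c.typ i.castSucc)) :
    Le (.app D c.compl (Family.compl_mem_full hc hD) rfl φ)
      (fNot (.app D c hc rfl φ : C.FullFm c.out)) :=
  valid_of_valid_fAnd (.a4 hc hD φ)

end

section

variable {k : ℕ+} {φ φ' ψ ψ' χ ρ : C.FullFm k}

theorem compl_compl_fAnd : Formula.app (k := k) (C.clsBin k) (skAnd k).compl.compl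
    (Family.compl_mem_full (Family.compl_mem_full (C.and_mem k) rfl) rfl) rfl
    (fun i : Fin 2 => (![φ, ψ] : Fin 2 → C.FullFm k) i) = fAnd φ ψ :=
  eq_of_heq (app_heq (F := C.toFamily) (D := C.clsBin k) (skAnd k).compl_compl rfl
    fun _ => HEq.rfl)

/-- `-[∧]` applied to two formulas. -/
def fNand (φ ψ : C.FullFm k) : C.FullFm k :=
  .app (C.clsBin k) (skAnd k).compl (Family.compl_mem_full (C.and_mem k) rfl) rfl
    fun i : Fin 2 => ![φ, ψ] i

/-- A4 does not apply to variables, so `φ` is replaced by the equivalent `φ ∧ φ`. There A4 applies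
to `∧` and to `-∧`, and `-(-∧) = ∧`. -/
theorem fNot_fNot_le : Le (fNot (fNot φ)) φ := by
  have h₁ : Le (fNand φ φ) (fNot (fAnd φ φ)) := le_fNot_app (C.and_mem k) rfl _
  have h₂ : Le (fNot (fNand φ φ)) _ := fNot_app_le (D := C.clsBin k) (c := (skAnd k).compl) _ rfl _
  have h₃ : Le (fNot (fNand φ φ)) (fAnd φ φ) := compl_compl_fAnd ▸ h₂
  exact (fNot_le_fNot (fNot_le_fNot (.a1 φ))).trans
    ((fNot_le_fNot h₁).trans (h₃.trans fAnd_le_left))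

theorem le_fNot_fNot : Le φ (fNot (fNot φ)) := by
  have h₁ : Le (fNot (fAnd φ φ)) (fNand φ φ) := fNot_app_le (C.and_mem k) rfl _
  have h₂ : Le _ (fNot (fNand φ φ)) := le_fNot_app (D := C.clsBin k) (c := (skAnd k).compl) _ rfl _
  have h₃ : Le (fAnd φ φ) (fNot (fNand φ φ)) := compl_compl_fAnd ▸ h₂
  exact Le.trans (.a1 φ) (h₃.trans
    ((fNot_le_fNot h₁).trans (fNot_le_fNot (fNot_le_fNot fAnd_le_left))))

theorem fNot_le_comm (h : Le (fNot φ) ψ) : Le (fNot ψ) φ := (fNot_le_fNot h).trans fNot_fNot_le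

theorem le_fNot_comm (h : Le φ (fNot ψ)) : Le ψ (fNot φ) := le_fNot_fNot.trans (fNot_le_fNot h)

theorem leS_fNot_iff {s : Sgn} : LeS (s + 1) (fNot φ) (fNot ψ) ↔ LeS s φ ψ := by
  rw [leS_swap]
  have : ∀ {φ ψ : C.FullFm k}, Le (fNot ψ) (fNot φ) ↔ Le φ ψ :=
    ⟨fun h => (le_fNot_comm h).trans fNot_fNot_le, fNot_le_fNot⟩
  rcases sgn_cases s with rfl | rfl
  · exact this
  · exact this

/-- A3 commutes a negated conjunction; double negation removes the negation. -/
theorem fAnd_comm_le : Le (fAnd φ ψ) (fAnd ψ φ) :=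
  le_fNot_fNot.trans (fNot_le_comm fNot_fAnd_comm)

theorem fNot_fAnd_le_fNot (h : Le (fAnd φ ψ) χ) : Le (fAnd (fNot χ) ψ) (fNot φ) :=
  (fAnd_le_fAnd (fNot_le_fNot h) (le_refl ψ)).trans fNot_fAnd_fAnd_le

theorem LeS.congr_left {s : Sgn} (h₁ : Le φ φ') (h₂ : Le φ' φ) : LeS s φ ψ ↔ LeS s φ' ψ := by
  rcases sgn_cases s with rfl | rfl
  · exact ⟨fun h : Le ψ φ => h.trans h₁, fun h : Le ψ φ' => h.trans h₂⟩
  · exact ⟨fun h : Le φ ψ => h₂.trans h, fun h : Le φ' ψ => h₁.trans h⟩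

theorem LeS.congr_right {s : Sgn} (h₁ : Le ψ ψ') (h₂ : Le ψ' ψ) : LeS s φ ψ ↔ LeS s φ ψ' := by
  rw [← leS_swap, ← leS_swap (φ := φ)]
  exact LeS.congr_left h₁ h₂

end

theorem leConn_compl_iff {D : C.toFamily.Cls} (c : Skeleton (C.toFamily.arity D))
    (hc : c ∈ C.toFamily.full D) (hD : C.toFamily.isVar D = false)
    (φ : ∀ i, C.FullFm (c.typ i)) :
    leConn D c hc φ ↔ leConn D c.compl (Family.compl_mem_full hc hD)
      (starAt (T := C.FullFm) fNot (Fin.last _) φ) := by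
  let W : ∀ i, C.FullFm (c.typ i) := starAt (T := C.FullFm) fNot (Fin.last _) φ
  have h₁ : (fun i : Fin (C.toFamily.arity D) => W i.castSucc) = fun i : Fin _ => φ i.castSucc :=
    funext fun i => if_neg (Fin.castSucc_lt_last i).ne
  have h₂ : W (Fin.last _) = fNot (φ (Fin.last _)) := if_pos rfl
  change _ ↔ LeS c.compl.quant (.app D c.compl (Family.compl_mem_full hc hD) rfl
    (fun i : Fin (C.toFamily.arity D) => W i.castSucc)) (W (Fin.last _))
  rw [h₁, h₂, quant_compl]
  exact leS_fNot_iff.symm.trans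
    (LeS.congr_left (fNot_app_le hc hD _) (le_fNot_app hc hD _))

section

variable {k : ℕ+} {φ φ' ψ ψ' χ ρ : C.FullFm k}

/-- The disjunction of two formulas. -/
def fOr (φ ψ : C.FullFm k) : C.FullFm k :=
  .app (C.clsBin k) (skOr k) (C.or_mem k) rfl (fun i : Fin 2 => ![φ, ψ] i)

/-- The connective `¬'` on formulas. -/
def fNot' (φ : C.FullFm k) : C.FullFm k :=
  .app (C.clsNot k) (skNot' k) (C.not'_mem k) rfl fun _ => φ

theorem le_fOr_iff : Le φ (fOr ψ χ) ↔ Le (fAnd (fNot ψ) (fNot χ)) (fNot φ) := by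
  have h := rel_or_iff (C := C) (T := C.FullFm) (P := leConn (C.clsBin k)) (st := fNot)
    (fun c hc j x => leConn_resid_iff c hc j x) leConn_compl_iff ψ χ φ
  unfold leConn at h
  erw [cons_castSucc_three, cons_castSucc_three] at h
  exact h

theorem fOr_le_fOr_right (h : Le ψ ψ') : Le (fOr χ ψ) (fOr χ ψ') :=
  le_fOr_iff.2 ((fAnd_le_fAnd (le_refl _) (fNot_le_fNot h)).trans (le_fOr_iff.1 (le_refl _)))

theorem le_fNot'_iff : Le φ (fNot' ψ) ↔ Le (fNot (fNot ψ)) (fNot φ) := by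
  have h := rel_not'_iff (C := C) (T := C.FullFm) (P := leConn (C.clsNot k)) (st := fNot)
    (fun c hc j x => leConn_resid_iff c hc j x) leConn_compl_iff ψ φ
  unfold leConn at h
  erw [cons_castSucc_two, cons_castSucc_two] at h
  exact h

theorem le_fNot'_iff_le_fNot : Le φ (fNot' ψ) ↔ Le φ (fNot ψ) :=
  le_fNot'_iff.trans (leS_fNot_iff (s := 0))

/-- The Hilbert counterpart of the shift rule between `X, Y ⊢ Z` and `X ⊢ Z, *Y`. -/
theorem le_fOr_fNot_iff : Le φ (fOr χ (fNot ψ)) ↔ Le (fAnd φ ψ) χ := by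
  rw [le_fOr_iff]
  constructor
  · intro h
    have := fNot_fAnd_le_fNot (Le.trans (fAnd_le_fAnd (le_refl _) le_fNot_fNot) h)
    exact ((fAnd_le_fAnd le_fNot_fNot (le_refl _)).trans this).trans fNot_fNot_le
  · intro h
    exact (fAnd_le_fAnd (le_refl _) fNot_fNot_le).trans (fNot_fAnd_le_fNot h)

end

/-! ## From the display calculus to the Hilbert calculus -/

theorem Struct.signed_star_add_one {F : Family.{u}} {M : F.Sub} {k : ℕ+} {s : Sgn}
    (X : Struct F M k) : X.star.Signed (s + 1) ↔ X.Signed s := by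
  cases X with
  | form φ => exact Iff.rfl
  | starForm φ => exact Iff.rfl
  | app D c hc hk X =>
    cases hD : F.isVar D with
    | true => simp [Struct.star, hD, Struct.Signed]
    | false =>
      rw [Struct.star_app hD]
      simp only [Struct.Signed, quant_compl, add_left_inj]
      refine and_congr_right fun _ => forall_congr' fun i => ?_
      rw [← side_castSucc, ← side_compl, side_castSucc, quant_compl]
      exact Iff.rfl
  | starApp D hD c hc hk X =>
    simp only [Struct.star, Struct.Signed]
    refine and_congr_left fun _ => ?_
    generalize c.quant = q
    revert s q
    decide

/-- Translation commutes with `*` only up to provable equivalence: A4 is needed when `*` negates a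
connective, double negation when it cancels a star. -/
theorem tau_star_le {k : ℕ+} (X : C.Str k) : Le (tau X.star) (fNot (tau X)) := by
  cases X with
  | form φ => exact le_refl _
  | starForm φ => exact le_fNot_fNot
  | app D c hc hk X =>
    subst hk
    cases hD : C.toFamily.isVar D with
    | true => simp only [Struct.star, hD]; exact le_refl _
    | false => rw [Struct.star_app hD]; exact le_fNot_app hc hD _
  | starApp D hD c hc hk X => exact le_fNot_fNot

theorem fNot_le_tau_star {k : ℕ+} (X : C.Str k) : Le (fNot (tau X)) (tau X.star) := by
  cases X with
  | form φ => exact le_refl _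
  | starForm φ => exact fNot_fNot_le
  | app D c hc hk X =>
    subst hk
    cases hD : C.toFamily.isVar D with
    | true => simp only [Struct.star, hD]; exact le_refl _
    | false => rw [Struct.star_app hD]; exact fNot_app_le hc hD _
  | starApp D hD c hc hk X => exact fNot_fNot_le

/-- The translation of the sequent is provable if it is defined. -/
def Sequent.Provable (S : Sequent C.toFamily C.toFamily.Mem) : Prop :=
  S.ant.Signed 1 → S.con.Signed 0 → Le (tau S.ant) (tau S.con)

theorem provable_seq {k : ℕ+} {s : Sgn} {X Y : C.Str k} :
    (seq s X Y).Provable ↔ (X.Signed s → Y.Signed (s + 1) → LeS s (tau X) (tau Y)) := by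
  rcases sgn_cases s with rfl | rfl
  · exact ⟨fun h hX hY => h hY hX, fun h hY hX => h hX hY⟩
  · exact Iff.rfl

theorem provable_seq_app {D : C.toFamily.Cls} {c : Skeleton (C.toFamily.arity D)}
    {hc : c ∈ C.toFamily.full D} {X : ∀ i : Fin (C.toFamily.arity D), C.Str (c.typ i.castSucc)}
    {U : C.Str c.out} :
    (seq c.quant (.app D c hc rfl X) U).Provable ↔
      ((∀ i, (X i).Signed (c.side i.castSucc)) → U.Signed (c.side (Fin.last _)) →
        LeS c.quant (.app D c hc rfl fun i => tau (X i)) (tau U)) := by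
  rw [provable_seq, side_last]
  simp only [side_castSucc, Struct.Signed, true_and]
  exact Iff.rfl

theorem provable_seqConn {D : C.toFamily.Cls} {c : Skeleton (C.toFamily.arity D)}
    {hc : c ∈ C.toFamily.full D} {X : ∀ i, C.Str (c.typ i)} :
    (seqConn D c hc X).Provable ↔
      ((∀ i, (X i).Signed (c.side i)) → leConn D c hc fun i => tau (X i)) := by
  refine provable_seq_app.trans ⟨fun h hX => h (fun i => hX _) (hX _), fun h h₁ h₂ => h fun i => ?_⟩
  induction i using Fin.lastCases with
  | last => exact h₂
  | cast i => exact h₁ i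

section

variable {k : ℕ+} {X Y : C.Str k}

theorem tau_comp_two : (fun i : Fin 2 => tau ((![X, Y] : Fin 2 → C.Str k) i)) =
    fun i : Fin 2 => (![tau X, tau Y] : Fin 2 → C.FullFm k) i := by
  funext i; fin_cases i <;> rfl

theorem tau_sAnd : tau (sAnd X Y) = fAnd (tau X) (tau Y) :=
  congrArg (Formula.app (k := k) (C.clsBin k) (skAnd k) (C.and_mem k) rfl) tau_comp_two

theorem tau_sOr : tau (sOr X Y) = fOr (tau X) (tau Y) :=
  congrArg (Formula.app (k := k) (C.clsBin k) (skOr k) (C.or_mem k) rfl) tau_comp_two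

theorem signed_sAnd : (sAnd X Y).Signed 1 ↔ X.Signed 1 ∧ Y.Signed 1 := by
  refine ⟨fun h => ⟨h.2 (0 : Fin 2), h.2 (1 : Fin 2)⟩, fun h => ⟨rfl, fun i => ?_⟩⟩
  change Fin 2 at i
  fin_cases i
  · exact h.1
  · exact h.2

theorem quant_skOr (k : ℕ+) : (skOr k).quant = 0 := by
  simp [skOr, quant]; decide

theorem side_skOr (k : ℕ+) (i : Fin 2) : (skOr k).quant + (skOr k).ton i.castSucc = 0 := by
  rw [quant_skOr]; fin_cases i <;> rfl

theorem signed_sOr : (sOr X Y).Signed 0 ↔ X.Signed 0 ∧ Y.Signed 0 := by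
  refine ⟨fun h => ⟨side_skOr k 0 ▸ h.2 (0 : Fin 2), side_skOr k 1 ▸ h.2 (1 : Fin 2)⟩,
    fun h => ⟨(quant_skOr k).symm, fun i => ?_⟩⟩
  change Fin 2 at i
  refine (side_skOr k i).symm ▸ ?_
  fin_cases i
  · exact h.1
  · exact h.2

theorem signed_sNot : (sNot X).Signed 1 ↔ X.Signed 0 := by
  refine ⟨fun h => side_skNot k ▸ h.2 (0 : Fin 1), fun h => ⟨rfl, fun i => ?_⟩⟩
  change Fin 1 at i
  obtain rfl := Subsingleton.elim i 0
  exact (side_skNot k).symm ▸ h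

theorem quant_skNot' (k : ℕ+) : (skNot' k).quant = 0 := by
  simp [skNot', quant]; decide

theorem side_skNot' (k : ℕ+) : (skNot' k).quant + (skNot' k).ton (Fin.castSucc 0) = 1 := by
  rw [quant_skNot']; rfl

theorem signed_sNot' : (sNot' X).Signed 0 ↔ X.Signed 1 := by
  refine ⟨fun h => side_skNot' k ▸ h.2 (0 : Fin 1), fun h => ⟨(quant_skNot' k).symm, fun i => ?_⟩⟩
  change Fin 1 at i
  obtain rfl := Subsingleton.elim i 0
  exact (side_skNot' k).symm ▸ h

theorem signed_sI : (sI : C.Str k).Signed 1 := ⟨rfl, fun i => Fin.elim0 i⟩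

end

/-- In each case the signs of the conclusion force those of the premises, which makes the induction
hypothesis applicable. -/
theorem provable_of_display {S : Sequent C.toFamily C.toFamily.Mem}
    (h : Display C C.toFamily.Mem (mem_subset_full C.toFamily) S) : S.Provable := by
  induction h with
  | @dr1 D c hc j X _ ih =>
    refine provable_seqConn.2 fun hX => ?_
    rw [provable_seqConn] at ih
    refine leConn_resid hc j _ (ih ?_)
    -- The signs are known for the permuted tuple; reindexing by the transposition gives them for
    -- the premise.
    refine (Equiv.swap j.castSucc (Fin.last _)).surjective.forall.2 fun i => ?_
    have := hX i
    rw [side_resid] at this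
    exact this
  | dr2 s X Y _ ih =>
    rw [provable_seq, Struct.signed_star_add_one, Struct.signed_star_add_one] at *
    intro hX hY
    rw [LeS.congr_left (tau_star_le X) (fNot_le_tau_star X),
      LeS.congr_right (tau_star_le Y) (fNot_le_tau_star Y), leS_fNot_iff]
    exact ih hX hY
  | conn_right hc X φ _ ih =>
    rw [provable_seq_app]
    intro hX _
    refine leS_app _ _ _ _ fun i => ?_
    have := provable_seq.1 (ih i)
    rw [← side_castSucc] at this ⊢
    exact this (hX i) trivial
  | conn_left hc φ U _ ih =>
    rw [provable_seq]
    intro _ hU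
    refine provable_seq_app.1 ih (fun _ => trivial) ?_
    rwa [side_last]
  | ci X Y U _ ih =>
    intro h₁ h₂
    obtain ⟨hY, hX⟩ := signed_sAnd.1 h₁
    have := ih (signed_sAnd.2 ⟨hX, hY⟩) h₂
    simp only [tau_sAnd] at this ⊢
    exact fAnd_comm_le.trans this
  | weak X Y U _ ih =>
    intro h₁ h₂
    simp only [tau_sAnd]
    exact fAnd_le_left.trans (ih (signed_sAnd.1 h₁).1 h₂)
  | wi X U _ ih =>
    intro h₁ h₂
    have := ih (signed_sAnd.2 ⟨h₁, h₁⟩) h₂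
    simp only [tau_sAnd] at this
    exact Le.trans (.a1 _) this
  | @iwi k X U _ ih =>
    intro h₁ h₂
    have := ih (signed_sAnd.2 ⟨h₁, signed_sI⟩) h₂
    have e : tau (sI : C.Str k) = fTop :=
      eq_of_heq (app_heq (F := C.toFamily) (D := C.clsConst k) rfl rfl fun i => Fin.elim0 i)
    simp only [tau_sAnd, e] at this
    exact (le_fAnd_of_valid .a0).trans this
  | shift X Y Z _ ih =>
    intro h₁ h₂
    obtain ⟨hZ, hY⟩ := signed_sOr.1 h₂
    have := ih (signed_sAnd.2 ⟨h₁, (Struct.signed_star_add_one Y).1 hY⟩) hZ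
    simp only [tau_sAnd, tau_sOr] at this ⊢
    exact (le_fOr_fNot_iff.2 this).trans (fOr_le_fOr_right (fNot_le_tau_star Y))
  | shift_inv X Y Z _ ih =>
    intro h₁ h₂
    obtain ⟨hX, hY⟩ := signed_sAnd.1 h₁
    have := ih hX (signed_sOr.2 ⟨h₂, (Struct.signed_star_add_one Y).2 hY⟩)
    simp only [tau_sAnd, tau_sOr] at this ⊢
    exact le_fOr_fNot_iff.1 (Le.trans this (fOr_le_fOr_right (tau_star_le Y)))
  | not_star X U _ ih =>
    intro h₁ h₂
    exact (tau_star_le X).trans (ih (signed_sNot.2 ((Struct.signed_star_add_one X).1 h₁)) h₂)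
  | star_not X U _ ih =>
    intro h₁ h₂
    exact (fNot_le_tau_star X).trans
      (ih ((Struct.signed_star_add_one X).2 (signed_sNot.1 h₁)) h₂)
  | not'_star X U _ ih =>
    intro h₁ h₂
    have := ih h₁ (signed_sNot'.2 ((Struct.signed_star_add_one X).1 h₂))
    exact (le_fNot'_iff_le_fNot.1 this).trans (fNot_le_tau_star X)
  | star_not' X U _ ih =>
    intro h₁ h₂
    have := ih h₁ ((Struct.signed_star_add_one X).2 (signed_sNot'.1 h₂))
    exact le_fNot'_iff_le_fNot.2 (Le.trans this (tau_star_le X))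

end AtomicLogic

theorem mainTheorem4 (C : AtomicLogic.BoolFamily.{u}) (k : ℕ+) (X Y : C.Str k)
    (hX : X.Signed 1) (hY : Y.Signed 0) :
    AtomicLogic.GGL C X Y ↔
      AtomicLogic.AHL C
        (AtomicLogic.BoolFamily.fImp (AtomicLogic.tau X) (AtomicLogic.tau Y)) :=
  ⟨fun h => AtomicLogic.provable_of_display h hX hY, fun h => h.ggl hX hY⟩
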